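/- Let $\alpha\in\mathbb{C}$ with $\operatorname{Re}\alpha>0$. For $-\infty\le a<b\le\infty$ let $J[f](x)=\int_a^x f(y)\,dy$ be the integration operator and $$\widetilde J^{\alpha}[f](x)=\frac1{\Gamma(\alpha)}\int_a^x f(y)(x-y)^{\alpha-1}\,dy$$ the Riemann–Liouville fractional integral. Put $P_n(\alpha)=\frac{(-1)^n}{n!}\prod_{m=0}^{n-1}(\alpha-m)$. Then $J^\alpha=\widetilde J^\alpha$ in the following sense. 1. Let $-\infty<a<b<\infty$. Then $J$ and $\widetilde J^\alpha$ are bounded operators on the complex space $L^1(a,b)$, and $\widetilde J^\alpha$ is the fractional power $J^\alpha$ of $J$: $$\widetilde J^\alpha=\lim_{\varepsilon\to0^+}(J+\varepsilon)^\alpha,\qquad (J+\varepsilon)^\alpha=\frac1{2\pi i}\oint_{\Gamma_\varepsilon}\lambda^\alpha(\lambda-J-\varepsilon)^{-1}\,d\lambda,$$ where $\Gamma_\varepsilon$ is a circle that encloses the spectrum of $J+\varepsilon$ and bounds a closed disc in $\mathbb{C}\setminus(-\infty,0]$, and $\lambda^\alpha$ is the principal branch; and for every $\rho>0$ $$\widetilde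 J^\alpha=\sum_{n=0}^\infty\Big[\sum_{k=0}^nP_k(n)\rho^{\alpha-k}J^k\Big]P_n(\alpha).$$ The limit and the series (its sequence of partial sums) converge in the operator norm. 2. Let $-\infty\le a<b\le\infty$, $\rho>0$ and $f\in L^1(a,b)$; if $a=-\infty$, suppose also that $f(x)=\mathcal{O}(e^{\varepsilon x})$ as $x\to-\infty$ (for almost every $x$) for some $\varepsilon>1/\rho$. Let $c\le b$ be a finite real number. Then $J^kf\in L^1(a,c)$ for all $k\ge 0$, the integral that defines $\widetilde J^\alpha[f](x)$ converges absolutely for almost every $x\in(a,c)$, $\widetilde J^\alpha[f]\in L^1(a,c)$, and $$\widetilde J^\alpha[f]=\sum_{n=0}^\infty\Big[\sum_{k=0}^nP_k(n)\rho^{\alpha-k}J^k[f]\Big]P_n(\alpha)$$ with convergence of the partial sums in the norm of $L^1(a,c)$. -/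

import Mathlib

open MeasureTheory Filter Topology Set

noncomputable section

namespace FracInt

/-! ### Interpolation of integer powers -/

/-- The Pochhammer-Newton polynomial `P_n(α) = (-1)^n / n! * ∏_{m < n} (α - m)`. -/
def pochhammerNewton (n : ℕ) (α : ℂ) : ℂ :=
  (-1) ^ n / (n.factorial : ℂ) * ∏ m ∈ Finset.range n, (α - m)

/-- The `N`-th partial sum of the Newton series
`∑_n (∑_{k ≤ n} P_k(n) ρ^(α - k) T^k) P_n(α)` of a bounded operator `T`. -/
def newtonSum {X : Type*} [NormedAddCommGroup X] [NormedSpace ℂ X]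
    (ρ : ℝ) (α : ℂ) (T : X →L[ℂ] X) (N : ℕ) : X →L[ℂ] X :=
  ∑ n ∈ Finset.range N, pochhammerNewton n α •
    ∑ k ∈ Finset.range (n + 1), (pochhammerNewton k n * (ρ : ℂ) ^ (α - k)) • T ^ k

/-! ### Fractional powers through the holomorphic functional calculus -/

/-- `S = (2πi)⁻¹ ∮_Γ λ^α (λ - T)⁻¹ dλ`, where `Γ` is a circle that encloses the spectrum of `T` and
bounds a disc in the slit plane, on which the principal branch of `λ^α` is holomorphic. By Cauchy's
theorem `S` does not depend on the choice of `Γ`. -/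
def IsHolomorphicPower {X : Type*} [NormedAddCommGroup X] [NormedSpace ℂ X]
    (T : X →L[ℂ] X) (α : ℂ) (S : X →L[ℂ] X) : Prop :=
  ∃ (c : ℂ) (R : ℝ), Metric.closedBall c R ⊆ Complex.slitPlane ∧
    spectrum ℂ T ⊆ Metric.ball c R ∧
    S = (2 * Real.pi * Complex.I : ℂ)⁻¹ • ∮ z in C(c, R), z ^ α • resolvent T z

/-- `S = T^α`, understood as `lim_{ε → 0+} (T + ε)^α` in the operator norm, each `(T + ε)^α` being
given by the holomorphic functional calculus. -/
def IsFractionalPower {X : Type*} [NormedAddCommGroup X] [NormedSpace ℂ X]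
    (T : X →L[ℂ] X) (α : ℂ) (S : X →L[ℂ] X) : Prop :=
  ∃ E : ℝ → (X →L[ℂ] X),
    (∀ ε : ℝ, 0 < ε → IsHolomorphicPower (T + (ε : ℂ) • ContinuousLinearMap.id ℂ X) α (E ε)) ∧
    Tendsto E (𝓝[>] 0) (𝓝 S)

/-! ### Integration and the Riemann-Liouville integral, on functions -/

/-- The open interval `(a, b)` of real numbers, with endpoints that may be infinite. -/
def interval (a b : EReal) : Set ℝ := {x : ℝ | a < (x : EReal) ∧ (x : EReal) < b}

/-- `J[f](x) = ∫_a^x f(y) dy`. -/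
def integ (a : EReal) (f : ℝ → ℂ) (x : ℝ) : ℂ := ∫ y in interval a x, f y

/-- The Riemann-Liouville integral `Γ(α)⁻¹ ∫_a^x f(y) (x - y)^(α - 1) dy`. -/
def riemannLiouville (a : EReal) (α : ℂ) (f : ℝ → ℂ) (x : ℝ) : ℂ :=
  (Complex.Gamma α)⁻¹ * ∫ y in interval a x, f y * ((x - y : ℝ) : ℂ) ^ (α - 1)

/-- The partial sums of the Newton series of `J`, applied to a function `f`. -/
def newtonSumFun (a : EReal) (ρ : ℝ) (α : ℂ) (f : ℝ → ℂ) (N : ℕ) (x : ℝ) : ℂ :=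
  ∑ n ∈ Finset.range N, pochhammerNewton n α *
    ∑ k ∈ Finset.range (n + 1),
      pochhammerNewton k n * (ρ : ℂ) ^ (α - k) * (integ a)^[k] f x

/-! ### The same operators on `L¹(a, b)` for a bounded interval -/

/-- The complex space `L¹(a, b)`. -/
abbrev L1 (a b : ℝ) := Lp ℂ 1 (volume.restrict (Ioo a b))

theorem interval_coe (a b : ℝ) : interval a b = Ioo a b := by
  ext x; simp [interval]

/-- Integration against a difference kernel, `∫_a^x f(y) k(x - y) dy`. -/
def volterra (a : ℝ) (k f : ℝ → ℂ) (x : ℝ) : ℂ := ∫ y in Ioo a x, f y * k (x - y)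

theorem volterra_aux {a b : ℝ} (k f : ℝ → ℂ) {x : ℝ} (hx : x ∈ Ioo a b) :
    (fun y => ContinuousLinearMap.mul ℂ ℂ ((Ioo a b).indicator f y)
      ((Ioo 0 (b - a)).indicator k (x - y))) =
    (Ioo a x).indicator (fun y => f y * k (x - y)) := by
  funext y
  obtain ⟨h1, h2⟩ := hx
  by_cases hy : y ∈ Ioo a x
  · have e1 : y ∈ Ioo a b := ⟨hy.1, hy.2.trans h2⟩
    have e2 : x - y ∈ Ioo 0 (b - a) := ⟨by linarith [hy.2], by linarith [hy.1]⟩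
    simp [hy, e1, e2]
  · rw [indicator_of_notMem hy]
    by_cases h : y ∈ Ioo a b
    · have e2 : x - y ∉ Ioo 0 (b - a) := fun h' => hy ⟨h.1, by linarith [h'.1]⟩
      simp [e2]
    · simp [h]

theorem volterra_eq {a b : ℝ} (k f : ℝ → ℂ) {x : ℝ} (hx : x ∈ Ioo a b) :
    volterra a k f x = MeasureTheory.convolution ((Ioo a b).indicator f)
      ((Ioo 0 (b - a)).indicator k) (ContinuousLinearMap.mul ℂ ℂ) volume x := by
  rw [MeasureTheory.convolution, volterra_aux k f hx, integral_indicator measurableSet_Ioo,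
    volterra]

theorem ae_integrableOn_volterra {a b : ℝ} {k f : ℝ → ℂ} (hk : IntegrableOn k (Ioo 0 (b - a)))
    (hf : IntegrableOn f (Ioo a b)) :
    ∀ᵐ x ∂(volume.restrict (Ioo a b)), IntegrableOn (fun y => f y * k (x - y)) (Ioo a x) := by
  rw [ae_restrict_iff' measurableSet_Ioo]
  filter_upwards [Integrable.ae_convolution_exists (ContinuousLinearMap.mul ℂ ℂ)
    (hf.integrable_indicator measurableSet_Ioo)
    (hk.integrable_indicator measurableSet_Ioo)] with x hx hxab
  rw [ConvolutionExistsAt, volterra_aux k f hxab] at hx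
  exact (integrable_indicator_iff measurableSet_Ioo).1 hx

theorem integrable_volterra {a b : ℝ} {k f : ℝ → ℂ} (hk : IntegrableOn k (Ioo 0 (b - a)))
    (hf : IntegrableOn f (Ioo a b)) :
    Integrable (volterra a k f) (volume.restrict (Ioo a b)) := by
  have h := Integrable.integrable_convolution (ContinuousLinearMap.mul ℂ ℂ)
    (hf.integrable_indicator measurableSet_Ioo) (hk.integrable_indicator measurableSet_Ioo)
  exact h.integrableOn.congr_fun (fun x hx => (volterra_eq k f hx).symm) measurableSet_Ioo

theorem integral_norm_volterra_le {a b : ℝ} {k f : ℝ → ℂ} (hk : IntegrableOn k (Ioo 0 (b - a)))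
    (hf : IntegrableOn f (Ioo a b)) :
    ∫ x in Ioo a b, ‖volterra a k f x‖ ≤
      (∫ x in Ioo 0 (b - a), ‖k x‖) * ∫ x in Ioo a b, ‖f x‖ := by
  have hF := hf.integrable_indicator measurableSet_Ioo
  have hK := hk.integrable_indicator measurableSet_Ioo
  have hc := Integrable.integrable_convolution (ContinuousLinearMap.mul ℂ ℂ) hF hK
  have hc' := Integrable.integrable_convolution (ContinuousLinearMap.mul ℝ ℝ) hF.norm hK.norm
  calc ∫ x in Ioo a b, ‖volterra a k f x‖
      = ∫ x in Ioo a b, ‖MeasureTheory.convolution ((Ioo a b).indicator f)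
          ((Ioo 0 (b - a)).indicator k) (ContinuousLinearMap.mul ℂ ℂ) volume x‖ :=
        setIntegral_congr_fun measurableSet_Ioo fun x hx => by
          simp only [volterra_eq k f hx]
    _ ≤ ∫ x, ‖MeasureTheory.convolution ((Ioo a b).indicator f)
          ((Ioo 0 (b - a)).indicator k) (ContinuousLinearMap.mul ℂ ℂ) volume x‖ :=
        setIntegral_le_integral hc.norm (Eventually.of_forall fun x => norm_nonneg _)
    _ ≤ ∫ x, MeasureTheory.convolution (fun x => ‖(Ioo a b).indicator f x‖)
          (fun x => ‖(Ioo 0 (b - a)).indicator k x‖) (ContinuousLinearMap.mul ℝ ℝ) volume x := by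
        refine integral_mono hc.norm hc' fun x => ?_
        refine (norm_integral_le_integral_norm _).trans (le_of_eq ?_)
        simp [MeasureTheory.convolution]
    _ = _ := by
        rw [integral_convolution _ hF.norm hK.norm, ContinuousLinearMap.mul_apply', mul_comm]
        simp only [norm_indicator_eq_indicator_norm]
        rw [integral_indicator measurableSet_Ioo, integral_indicator measurableSet_Ioo]

theorem integrableOn_coe {a b : ℝ} (f : L1 a b) : IntegrableOn (f : ℝ → ℂ) (Ioo a b) :=
  L1.integrable_coeFn f

/-- Two functions that agree almost everywhere on `(a, b)` have the same integrals. -/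
theorem volterra_congr {a b : ℝ} {k f g : ℝ → ℂ} (h : f =ᵐ[volume.restrict (Ioo a b)] g) {x : ℝ}
    (hx : x ∈ Ioo a b) : volterra a k f x = volterra a k g x := by
  refine integral_congr_ae ?_
  filter_upwards [ae_mono (Measure.restrict_mono (Ioo_subset_Ioo_right hx.2.le) le_rfl) h]
    with y hy
  rw [hy]

/-- `f ↦ ∫_a^x f(y) k(x - y) dy` as a bounded operator on `L¹(a, b)`. -/
def volterraOp (a b : ℝ) (k : ℝ → ℂ) (hk : IntegrableOn k (Ioo 0 (b - a))) :
    L1 a b →L[ℂ] L1 a b :=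
  LinearMap.mkContinuous
    { toFun := fun f => (integrable_volterra hk (integrableOn_coe f)).toL1 (volterra a k f)
      map_add' := fun f g => by
        rw [← Integrable.toL1_add, Integrable.toL1_eq_toL1_iff]
        filter_upwards [ae_integrableOn_volterra hk (integrableOn_coe f),
          ae_integrableOn_volterra hk (integrableOn_coe g),
          ae_restrict_mem measurableSet_Ioo] with x hf hg hx
        rw [volterra_congr (Lp.coeFn_add f g) hx, Pi.add_apply, volterra, volterra, volterra,
          ← integral_add hf hg]
        simp only [Pi.add_apply, add_mul]
      map_smul' := fun c f => by
        rw [RingHom.id_apply, ← Integrable.toL1_smul', Integrable.toL1_eq_toL1_iff]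
        filter_upwards [ae_restrict_mem measurableSet_Ioo] with x hx
        rw [volterra_congr (Lp.coeFn_smul c f) hx, Pi.smul_apply, volterra, volterra,
          ← integral_smul]
        simp only [Pi.smul_apply, smul_mul_assoc] }
    (∫ x in Ioo 0 (b - a), ‖k x‖) fun f => by
      rw [LinearMap.coe_mk, AddHom.coe_mk, L1.norm_eq_integral_norm, L1.norm_eq_integral_norm]
      refine le_trans (le_of_eq ?_) (integral_norm_volterra_le hk (integrableOn_coe f))
      refine integral_congr_ae ?_
      filter_upwards [Integrable.coeFn_toL1 (integrable_volterra hk (integrableOn_coe f))]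
        with x hx
      rw [hx]

theorem coeFn_volterraOp {a b : ℝ} {k : ℝ → ℂ} (hk : IntegrableOn k (Ioo 0 (b - a)))
    (f : L1 a b) : volterraOp a b k hk f =ᵐ[volume.restrict (Ioo a b)] volterra a k f :=
  Integrable.coeFn_toL1 (integrable_volterra hk (integrableOn_coe f))

/-- The kernel of the Riemann-Liouville integral. -/
def rlKernel (α : ℂ) (t : ℝ) : ℂ := (Complex.Gamma α)⁻¹ * (t : ℂ) ^ (α - 1)

theorem integrableOn_rlKernel {α : ℂ} (hα : 0 < α.re) (c : ℝ) :
    IntegrableOn (rlKernel α) (Ioo 0 c) := by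
  rcases le_or_gt c 0 with hc | hc
  · simp [Ioo_eq_empty_of_le hc]
  · have h := intervalIntegral.intervalIntegrable_cpow' (a := 0) (b := c) (r := α - 1)
      (by simp; linarith)
    rw [intervalIntegrable_iff_integrableOn_Ioo_of_le hc.le] at h
    exact h.const_mul _

/-- The integration operator `J : L¹(a, b) → L¹(a, b)`. -/
def integOp (a b : ℝ) : L1 a b →L[ℂ] L1 a b :=
  volterraOp a b (fun _ => 1) (integrableOn_const (by simp))

/-- The Riemann-Liouville operator of order `α` on `L¹(a, b)`, for `Re α > 0`. -/
def riemannLiouvilleOp (a b : ℝ) (α : ℂ) (hα : 0 < α.re) : L1 a b →L[ℂ] L1 a b :=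
  volterraOp a b (rlKernel α) (integrableOn_rlKernel hα _)

theorem coeFn_integOp {a b : ℝ} (f : L1 a b) :
    integOp a b f =ᵐ[volume.restrict (Ioo a b)] integ a f := by
  refine (coeFn_volterraOp _ f).trans (Eventually.of_forall fun x => ?_)
  simp [volterra, integ, interval_coe]

theorem coeFn_riemannLiouvilleOp {a b : ℝ} {α : ℂ} (hα : 0 < α.re) (f : L1 a b) :
    riemannLiouvilleOp a b α hα f =ᵐ[volume.restrict (Ioo a b)] riemannLiouville a α f := by
  refine (coeFn_volterraOp _ f).trans (Eventually.of_forall fun x => ?_)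
  simp only [volterra, riemannLiouville, interval_coe, rlKernel]
  rw [← integral_const_mul]
  congr 1
  funext y
  ring

end FracInt

end

noncomputable section

namespace FracInt


/-! Everything is convolution with kernels supported on `t > 0`. The power `J^(k+1)` has kernel `t^k
/ k!`, the Riemann-Liouville integral has kernel `t^(α-1) / Γ(α)`, and `P_k(n) = (-1)^k C(n, k)`.
Hence the inner sum of the Newton series is `ρ^α (1 - J/ρ)^n`, which is `ρ^α` times the identity
plus convolution with `ρ^(α-1) L_n'(t/ρ)`, where `L_n` is the Laguerre polynomial.

Newton series. The identity part disappears because `∑ P_n(α) = (1 - 1)^α = 0`. For the rest, `∑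
P_n(α) L_n(t) = t^α / Γ(α+1)` (`newtonLaguerreSum_eq`), and the differentiated series has to
converge to `t^(α-1) / Γ(α)` in `L¹(e^(-ηt) dt)` for `η > 1/ρ`, after scaling by `ρ`. One bound on
the error decays in `N` but behaves like `1/t` at `0`; another is integrable at `0` but grows like
`√N`. Their geometric mean with suitable weights does both (`exists_norm_newtonDefect_le`). Young's
inequality in the weighted space then gives convergence on functions (`newton_series_function`) and
in operator norm (`newton_series_operator`). The factor `e^t` in the Laguerre bounds is the reason
for the threshold `1/ρ`.

Fractional power. On a bounded interval `‖J^(k+1)‖ ≤ (b-a)^(k+1) / k!`, so the resolvent series of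
`J` converges off `0`, and integrating it termwise over a circle around `ε` turns `(J + ε)^α` into
the binomial series `shiftPow`. For `0 < Re β < 1` the terms `k ≥ 1` of this series sum to a
convolution whose kernel is the Riemann-Liouville kernel times a bounded factor of `t/ε` that tends
to `1` as `ε → 0` (an Euler integral), while the term `k = 0` is `ε^β → 0`; see
`tendsto_shiftPow_of_re_lt_one`. Both sides satisfy the semigroup law in the exponent, so writing `α
= (n+1)β` with `Re β < 1` gives all `α` (`tendsto_shiftPow`). -/

/-! ### Convolution of exponentially weighted functions on the line -/

/-- The convolution of two complex-valued functions on the line. -/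
abbrev cconv (f k : ℝ → ℂ) : ℝ → ℂ :=
  MeasureTheory.convolution f k (ContinuousLinearMap.mul ℂ ℂ) volume

/-- Convergence of the convolution integral at a point. -/
abbrev CConvExistsAt (f k : ℝ → ℂ) (x : ℝ) : Prop :=
  ConvolutionExistsAt f k x (ContinuousLinearMap.mul ℂ ℂ) volume

/-- The function `x ↦ e^(-ηx) f(x)`. -/
def expWeight (η : ℝ) (f : ℝ → ℂ) (x : ℝ) : ℂ := Real.exp (-(η * x)) • f x

/-- Integrability with respect to the weight `e^(-ηx)`. -/
def ExpIntegrable (η : ℝ) (f : ℝ → ℂ) : Prop := Integrable (expWeight η f)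

/-- The norm of the space `L¹(e^(-ηx) dx)`. -/
def expNorm (η : ℝ) (f : ℝ → ℂ) : ℝ := ∫ x, Real.exp (-(η * x)) * ‖f x‖

theorem norm_expWeight (η : ℝ) (f : ℝ → ℂ) (x : ℝ) :
    ‖expWeight η f x‖ = Real.exp (-(η * x)) * ‖f x‖ := by
  rw [expWeight, norm_smul, Real.norm_eq_abs, Real.abs_exp]

theorem integral_norm_expWeight (η : ℝ) (f : ℝ → ℂ) :
    ∫ x, ‖expWeight η f x‖ = expNorm η f := by
  simp only [norm_expWeight, expNorm]

theorem expNorm_nonneg (η : ℝ) (f : ℝ → ℂ) : 0 ≤ expNorm η f :=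
  integral_nonneg fun _ => by positivity

theorem expWeight_neg_expWeight (η : ℝ) (f : ℝ → ℂ) : expWeight (-η) (expWeight η f) = f := by
  funext x
  rw [expWeight, expWeight, smul_smul, ← Real.exp_add]
  simp

theorem ExpIntegrable.aestronglyMeasurable {η : ℝ} {f : ℝ → ℂ} (hf : ExpIntegrable η f) :
    AEStronglyMeasurable f volume := by
  rw [← expWeight_neg_expWeight η f]
  exact (by fun_prop : Continuous fun x : ℝ => Real.exp (-(-η * x))).aestronglyMeasurable.smul
    (Integrable.aestronglyMeasurable hf)

theorem expWeight_mul_expWeight (η : ℝ) (f k : ℝ → ℂ) (x y : ℝ) :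
    ContinuousLinearMap.mul ℂ ℂ (expWeight η f y) (expWeight η k (x - y)) =
      Real.exp (-(η * x)) • ContinuousLinearMap.mul ℂ ℂ (f y) (k (x - y)) := by
  have h : Real.exp (-(η * x)) = Real.exp (-(η * y)) * Real.exp (-(η * (x - y))) := by
    rw [← Real.exp_add]
    ring_nf
  simp only [expWeight, Complex.real_smul, ContinuousLinearMap.mul_apply', h]
  push_cast
  ring

/-- Since `e^(-ηx) = e^(-ηy) e^(-η(x-y))`, the weight is multiplicative for convolution, so the
weighted `L¹` theory reduces to the ordinary one. -/
theorem cconv_expWeight (η : ℝ) (f k : ℝ → ℂ) :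
    cconv (expWeight η f) (expWeight η k) = expWeight η (cconv f k) := by
  funext x
  simp only [cconv, MeasureTheory.convolution, expWeight_mul_expWeight]
  rw [integral_smul]
  rfl

theorem cconvExistsAt_expWeight {η : ℝ} {f k : ℝ → ℂ} {x : ℝ} :
    CConvExistsAt (expWeight η f) (expWeight η k) x ↔ CConvExistsAt f k x := by
  simp only [CConvExistsAt, ConvolutionExistsAt, expWeight_mul_expWeight]
  exact integrable_smul_iff (Real.exp_pos _).ne' _

theorem ExpIntegrable.ae_cconvExistsAt {η : ℝ} {f k : ℝ → ℂ} (hf : ExpIntegrable η f)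
    (hk : ExpIntegrable η k) : ∀ᵐ x, CConvExistsAt f k x := by
  filter_upwards [Integrable.ae_convolution_exists (ContinuousLinearMap.mul ℂ ℂ) hf hk] with x hx
  exact cconvExistsAt_expWeight.1 hx

theorem ExpIntegrable.convolution {η : ℝ} {f k : ℝ → ℂ} (hf : ExpIntegrable η f)
    (hk : ExpIntegrable η k) : ExpIntegrable η (cconv f k) := by
  have h : Integrable (cconv (expWeight η f) (expWeight η k)) :=
    Integrable.integrable_convolution (ContinuousLinearMap.mul ℂ ℂ) hf hk
  rwa [cconv_expWeight] at h

theorem expNorm_cconv_le {η : ℝ} {f k : ℝ → ℂ} (hf : ExpIntegrable η f)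
    (hk : ExpIntegrable η k) : expNorm η (cconv f k) ≤ expNorm η f * expNorm η k := by
  have hc' := Integrable.integrable_convolution (ContinuousLinearMap.mul ℝ ℝ)
    (Integrable.norm hf) (Integrable.norm hk)
  rw [← integral_norm_expWeight, ← cconv_expWeight]
  calc ∫ x, ‖cconv (expWeight η f) (expWeight η k) x‖
      ≤ ∫ x, MeasureTheory.convolution (fun x => ‖expWeight η f x‖)
          (fun x => ‖expWeight η k x‖) (ContinuousLinearMap.mul ℝ ℝ) volume x := by
        refine integral_mono ?_ hc' fun x => ?_
        · exact (Integrable.integrable_convolution (ContinuousLinearMap.mul ℂ ℂ) hf hk).norm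
        · refine (norm_integral_le_integral_norm _).trans (le_of_eq ?_)
          simp [MeasureTheory.convolution]
    _ = _ := by
        rw [integral_convolution _ (Integrable.norm hf) (Integrable.norm hk),
          ContinuousLinearMap.mul_apply', integral_norm_expWeight, integral_norm_expWeight]

theorem ae_cconv_assoc_of_integrable {f g k : ℝ → ℂ} (hf : Integrable f) (hg : Integrable g)
    (hk : Integrable k) : ∀ᵐ x, cconv (cconv f g) k x = cconv f (cconv g k) x := by
  have h := Integrable.integrable_convolution (ContinuousLinearMap.mul ℝ ℝ) hg.norm hk.norm
  filter_upwards [Integrable.ae_convolution_exists (ContinuousLinearMap.mul ℝ ℝ) hf.norm h]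
    with x hx
  refine convolution_assoc _ _ _ _ (fun a b c => ?_) hf.aestronglyMeasurable
    hg.aestronglyMeasurable hk.aestronglyMeasurable
    (Integrable.ae_convolution_exists (ContinuousLinearMap.mul ℂ ℂ) hf hg)
    (Integrable.ae_convolution_exists (ContinuousLinearMap.mul ℝ ℝ) hg.norm hk.norm) hx
  simp [mul_assoc]

theorem ExpIntegrable.ae_cconv_assoc {η : ℝ} {f g k : ℝ → ℂ} (hf : ExpIntegrable η f)
    (hg : ExpIntegrable η g) (hk : ExpIntegrable η k) :
    ∀ᵐ x, cconv (cconv f g) k x = cconv f (cconv g k) x := by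
  filter_upwards [ae_cconv_assoc_of_integrable hf hg hk] with x hx
  simp only [cconv_expWeight] at hx
  rw [expWeight, expWeight] at hx
  exact smul_right_injective ℂ (Real.exp_pos _).ne' hx

theorem cconv_add_right {f g k : ℝ → ℂ} {x : ℝ} (hg : CConvExistsAt f g x)
    (hk : CConvExistsAt f k x) : cconv f (g + k) x = cconv f g x + cconv f k x :=
  hg.distrib_add hk

theorem cconv_smul_right (f k : ℝ → ℂ) (c : ℂ) (x : ℝ) :
    cconv f (c • k) x = c * cconv f k x := by
  simp only [cconv, convolution_smul, Pi.smul_apply, smul_eq_mul]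

theorem CConvExistsAt.const_smul {f k : ℝ → ℂ} {x : ℝ} (h : CConvExistsAt f k x) (c : ℂ) :
    CConvExistsAt f (c • k) x := by
  refine (Integrable.const_mul h c).congr (Eventually.of_forall fun y => ?_)
  simp only [ContinuousLinearMap.mul_apply', Pi.smul_apply, smul_eq_mul]
  ring

theorem CConvExistsAt.sum {ι : Type*} {f : ℝ → ℂ} {k : ι → ℝ → ℂ} {x : ℝ} (s : Finset ι)
    (h : ∀ i ∈ s, CConvExistsAt f (k i) x) :
    CConvExistsAt f (∑ i ∈ s, k i) x ∧
      cconv f (∑ i ∈ s, k i) x = ∑ i ∈ s, cconv f (k i) x := by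
  classical
  induction s using Finset.induction_on with
  | empty =>
    simp only [Finset.sum_empty, cconv, convolution_zero, Pi.zero_apply, and_true]
    refine (integrable_zero ℝ ℂ volume).congr (Eventually.of_forall fun y => ?_)
    simp
  | insert i s hi ih =>
    obtain ⟨h1, h2⟩ := ih fun j hj => h j (Finset.mem_insert_of_mem hj)
    have h3 := h i (Finset.mem_insert_self i s)
    rw [Finset.sum_insert hi, Finset.sum_insert hi, ← h2, cconv_add_right h3 h1]
    refine ⟨?_, rfl⟩
    refine (Integrable.add h3 h1).congr (Eventually.of_forall fun y => ?_)
    simp [Finset.mul_sum, mul_add]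

/-! ### The Riemann-Liouville kernels on the line -/

/-- The kernel of the Riemann-Liouville integral, extended by zero to the negative half-line. -/
def causalKernel (α : ℂ) : ℝ → ℂ := (Ioi 0).indicator (rlKernel α)

theorem norm_cpow_sub_one {α : ℂ} {t : ℝ} (ht : 0 < t) :
    ‖(t : ℂ) ^ (α - 1)‖ = t ^ (α.re - 1) := by
  rw [Complex.norm_cpow_eq_rpow_re_of_pos ht]
  simp

theorem measurable_rlKernel (α : ℂ) : Measurable (rlKernel α) := by
  unfold rlKernel
  fun_prop

/-- The weight supplies the decay at infinity that the power lacks; `Re α > 0` handles the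
singularity at `0`. -/
theorem expIntegrable_causalKernel {η : ℝ} {α : ℂ} (hη : 0 < η) (hα : 0 < α.re) :
    ExpIntegrable η (causalKernel α) := by
  have h := (integrableOn_rpow_mul_exp_neg_mul_rpow (p := 1) (s := α.re - 1) (b := η)
    (by linarith) one_pos hη).const_mul ‖(Complex.Gamma α)⁻¹‖
  have hm : AEStronglyMeasurable (fun x => expWeight η (rlKernel α) x) volume :=
    (by fun_prop : Continuous fun x : ℝ => Real.exp (-(η * x))).aestronglyMeasurable.smul
      (measurable_rlKernel α).aestronglyMeasurable
  have h2 : IntegrableOn (expWeight η (rlKernel α)) (Ioi 0) := by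
    refine Integrable.mono' h hm.restrict ?_
    filter_upwards [ae_restrict_mem measurableSet_Ioi] with t ht
    rw [norm_expWeight, rlKernel, norm_mul, norm_cpow_sub_one ht, Real.rpow_one]
    apply le_of_eq
    ring_nf
  refine (h2.integrable_indicator measurableSet_Ioi).congr (Eventually.of_forall fun t => ?_)
  by_cases ht : t ∈ Ioi (0 : ℝ) <;> simp [expWeight, causalKernel, ht]

/-- Euler's beta integral: `B(α, β) = Γ(α) Γ(β) / Γ(α+β)`. This is the semigroup law at the level of
kernels. -/
theorem cconv_causalKernel {α β : ℂ} (hα : 0 < α.re) (hβ : 0 < β.re) :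
    cconv (causalKernel α) (causalKernel β) = causalKernel (α + β) := by
  funext x
  have key : ∀ y, ContinuousLinearMap.mul ℂ ℂ (causalKernel α y) (causalKernel β (x - y)) =
      (Ioo 0 x).indicator (fun y => (Complex.Gamma α)⁻¹ * (Complex.Gamma β)⁻¹ *
        ((y : ℂ) ^ (α - 1) * ((x : ℂ) - y) ^ (β - 1))) y := by
    intro y
    by_cases hy : y ∈ Ioo 0 x
    · have h1 : y ∈ Ioi (0 : ℝ) := hy.1
      have h2 : x - y ∈ Ioi (0 : ℝ) := by simpa using hy.2
      simp only [causalKernel, h1, h2, hy, indicator_of_mem, rlKernel,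
        ContinuousLinearMap.mul_apply']
      push_cast
      ring
    · rw [indicator_of_notMem hy]
      by_cases h1 : y ∈ Ioi (0 : ℝ)
      · have h2 : x - y ∉ Ioi (0 : ℝ) := fun h => hy ⟨h1, by simpa using h⟩
        simp [causalKernel, h2]
      · simp [causalKernel, h1]
  simp only [cconv, MeasureTheory.convolution, key]
  rw [integral_indicator measurableSet_Ioo, integral_const_mul]
  rcases le_or_gt x 0 with hx | hx
  · simp [causalKernel, hx]
  · rw [← integral_Ioc_eq_integral_Ioo, ← intervalIntegral.integral_of_le hx.le,
      Complex.betaIntegral_scaled α β hx, causalKernel, indicator_of_mem (mem_Ioi.2 hx), rlKernel,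
      Complex.betaIntegral_eq_Gamma_mul_div α β hα hβ]
    have h1 := Complex.Gamma_ne_zero_of_re_pos hα
    have h2 := Complex.Gamma_ne_zero_of_re_pos hβ
    field_simp

/-- On `x ≤ c` the convolution with a causal kernel only sees the values to the left of `c`. -/
theorem cconv_causalKernel_congr {α : ℂ} {f g : ℝ → ℂ} {c x : ℝ} (hx : x ≤ c)
    (h : ∀ᵐ y, y < c → f y = g y) : cconv f (causalKernel α) x = cconv g (causalKernel α) x := by
  refine integral_congr_ae ?_
  filter_upwards [h] with y hy
  by_cases hxy : y < x
  · rw [hy (hxy.trans_le hx)]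
  · have : x - y ∉ Ioi (0 : ℝ) := by simpa using hxy
    simp [causalKernel, this]

/-! ### Integrals over an interval as convolutions of truncated functions. -/

theorem measurableSet_interval (a b : EReal) : MeasurableSet (interval a b) :=
  (measurableSet_lt measurable_const measurable_coe_real_ereal).inter
    (measurableSet_lt measurable_coe_real_ereal measurable_const)

theorem interval_subset_Iio (a : EReal) (c : ℝ) : interval a c ⊆ Iio c :=
  fun _ hx => EReal.coe_lt_coe_iff.1 hx.2

theorem interval_mono {a b c : EReal} (h : b ≤ c) : interval a b ⊆ interval a c :=
  fun _ hx => ⟨hx.1, hx.2.trans_le h⟩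

theorem indicator_mul_causalKernel (a : EReal) {c x : ℝ} (hx : x ≤ c) (α : ℂ) (f : ℝ → ℂ) :
    (fun y => ContinuousLinearMap.mul ℂ ℂ ((interval a c).indicator f y)
      (causalKernel α (x - y))) =
    (interval a x).indicator fun y =>
      (Complex.Gamma α)⁻¹ * (f y * ((x - y : ℝ) : ℂ) ^ (α - 1)) := by
  funext y
  by_cases hy : y ∈ interval a x
  · have h1 : y ∈ interval a c := interval_mono (EReal.coe_le_coe_iff.2 hx) hy
    have h2 : x - y ∈ Ioi (0 : ℝ) := by simpa using interval_subset_Iio a x hy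
    simp only [h1, hy, h2, causalKernel, indicator_of_mem, rlKernel,
      ContinuousLinearMap.mul_apply']
    ring
  · rw [indicator_of_notMem hy]
    by_cases h1 : y ∈ interval a c
    · have h2 : x - y ∉ Ioi (0 : ℝ) := fun h =>
        hy ⟨h1.1, EReal.coe_lt_coe_iff.2 (by simpa using h)⟩
      simp [causalKernel, h2]
    · simp [h1]

theorem riemannLiouville_eq_cconv (a : EReal) {c x : ℝ} (hx : x ≤ c) (α : ℂ) (f : ℝ → ℂ) :
    riemannLiouville a α f x = cconv ((interval a c).indicator f) (causalKernel α) x := by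
  rw [cconv, MeasureTheory.convolution, indicator_mul_causalKernel a hx,
    integral_indicator (measurableSet_interval a x), integral_const_mul, riemannLiouville]

theorem CConvExistsAt.integrableOn {a : EReal} {c x : ℝ} (hx : x ≤ c) {α : ℂ} (hα : 0 < α.re)
    {f : ℝ → ℂ} (h : CConvExistsAt ((interval a c).indicator f) (causalKernel α) x) :
    IntegrableOn (fun y => f y * ((x - y : ℝ) : ℂ) ^ (α - 1)) (interval a x) := by
  rw [CConvExistsAt, ConvolutionExistsAt, indicator_mul_causalKernel a hx,
    integrable_indicator_iff (measurableSet_interval a x)] at h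
  have h2 := h.const_mul (Complex.Gamma α)
  refine h2.congr (Eventually.of_forall fun y => ?_)
  simp only
  rw [mul_inv_cancel_left₀ (Complex.Gamma_ne_zero_of_re_pos hα)]

theorem integ_eq_riemannLiouville (a : EReal) (f : ℝ → ℂ) (x : ℝ) :
    integ a f x = riemannLiouville a 1 f x := by
  simp [integ, riemannLiouville]

theorem cconv_causalKernel_eq_zero {a : EReal} {c x : ℝ} (hx : x < c) (hx' : x ∉ interval a c)
    (α : ℂ) (f : ℝ → ℂ) : cconv ((interval a c).indicator f) (causalKernel α) x = 0 := by
  rw [← riemannLiouville_eq_cconv a hx.le, riemannLiouville]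
  have : interval a x = ∅ := by
    ext y
    simp only [mem_empty_iff_false, iff_false]
    intro hy
    exact hx' ⟨hy.1.trans hy.2, EReal.coe_lt_coe_iff.2 hx⟩
  simp [this]

/-- Semigroup law, from associativity of convolution. It is phrased with a function `g` known only
almost everywhere because iterated integrals and elements of `L¹` are identified only up to null
sets. -/
theorem ae_riemannLiouville_of_ae_eq {a : EReal} {c η : ℝ} (hη : 0 < η) {f g : ℝ → ℂ}
    (hf : ExpIntegrable η ((interval a c).indicator f)) {α β : ℂ} (hα : 0 < α.re) (hβ : 0 < β.re)
    (hg : ∀ᵐ x, x ∈ interval a c → g x = riemannLiouville a α f x) :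
    ∀ᵐ x, x ∈ interval a c → riemannLiouville a β g x = riemannLiouville a (α + β) f x := by
  filter_upwards [hf.ae_cconv_assoc (expIntegrable_causalKernel hη hα)
    (expIntegrable_causalKernel hη hβ)] with x hx hxc
  have hle : x ≤ c := le_of_lt (interval_subset_Iio a c hxc)
  rw [riemannLiouville_eq_cconv a hle, riemannLiouville_eq_cconv a hle,
    ← cconv_causalKernel hα hβ, ← hx]
  refine cconv_causalKernel_congr hle ?_
  filter_upwards [hg] with y hy hyc
  by_cases hy' : y ∈ interval a c
  · rw [indicator_of_mem hy', hy hy', riemannLiouville_eq_cconv a hyc.le]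
  · rw [indicator_of_notMem hy', cconv_causalKernel_eq_zero hyc hy']

theorem natCast_succ_re_pos (k : ℕ) : 0 < ((k + 1 : ℕ) : ℂ).re := by
  rw [Complex.natCast_re]
  exact_mod_cast k.succ_pos

theorem ae_iterate_integ {a : EReal} {c η : ℝ} (hη : 0 < η) {f : ℝ → ℂ}
    (hf : ExpIntegrable η ((interval a c).indicator f)) (k : ℕ) :
    ∀ᵐ x, x ∈ interval a c → (integ a)^[k + 1] f x = riemannLiouville a (k + 1 : ℕ) f x := by
  induction k with
  | zero =>
    refine Eventually.of_forall fun x _ => ?_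
    simp only [zero_add, Function.iterate_one, Nat.cast_one]
    exact integ_eq_riemannLiouville a f x
  | succ k ih =>
    filter_upwards [ae_riemannLiouville_of_ae_eq hη hf (natCast_succ_re_pos k)
      (by simp : 0 < (1 : ℂ).re) ih] with x hx hxc
    rw [Function.iterate_succ_apply', integ_eq_riemannLiouville, hx hxc, Nat.cast_succ (k + 1)]

/-- To the left of `c` the weight is at least `e^(-ηc)`. This is how weighted estimates return to
`L¹(a, c)`, and why `c` is finite. -/
theorem ExpIntegrable.integrableOn_Iio {η : ℝ} (hη : 0 < η) {f : ℝ → ℂ}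
    (hf : ExpIntegrable η f) (c : ℝ) : IntegrableOn f (Iio c) ∧
      ∫ x in Iio c, ‖f x‖ ≤ Real.exp (η * c) * expNorm η f := by
  have hb : ∀ x ∈ Iio c, ‖f x‖ ≤ Real.exp (η * c) * ‖expWeight η f x‖ := by
    intro x hx
    rw [norm_expWeight, ← mul_assoc, ← Real.exp_add]
    refine le_mul_of_one_le_left (norm_nonneg _) (Real.one_le_exp ?_)
    have : η * x ≤ η * c := mul_le_mul_of_nonneg_left (le_of_lt hx) hη.le
    linarith
  have hi := (Integrable.norm hf).const_mul (Real.exp (η * c))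
  have h1 : IntegrableOn f (Iio c) := by
    refine Integrable.mono' hi.integrableOn hf.aestronglyMeasurable.restrict ?_
    filter_upwards [ae_restrict_mem measurableSet_Iio] with x hx using hb x hx
  refine ⟨h1, ?_⟩
  calc ∫ x in Iio c, ‖f x‖ ≤ ∫ x in Iio c, Real.exp (η * c) * ‖expWeight η f x‖ :=
        setIntegral_mono_on h1.norm hi.integrableOn measurableSet_Iio hb
    _ ≤ ∫ x, Real.exp (η * c) * ‖expWeight η f x‖ :=
        setIntegral_le_integral hi (Eventually.of_forall fun x => by positivity)
    _ = _ := by rw [integral_const_mul, integral_norm_expWeight]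


/-! ### Laguerre polynomials -/

/-- The Laguerre polynomial `L_n = ∑_k (-1)^k C(n, k) X^k / k!`. -/
def laguerre (n : ℕ) : Polynomial ℝ :=
  ∑ k ∈ Finset.range (n + 1), Polynomial.monomial k ((-1) ^ k * (n.choose k : ℝ) / k.factorial)

theorem coeff_laguerre (n k : ℕ) :
    (laguerre n).coeff k = (-1) ^ k * (n.choose k : ℝ) / k.factorial := by
  rw [laguerre, Polynomial.finsetSum_coeff]
  simp only [Polynomial.coeff_monomial, Finset.sum_ite_eq', Finset.mem_range]
  split_ifs with h
  · rfl
  · rw [Nat.choose_eq_zero_of_lt (by omega)]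
    simp

theorem eval_laguerre (n : ℕ) (t : ℝ) : (laguerre n).eval t =
    ∑ k ∈ Finset.range (n + 1), (-1) ^ k * (n.choose k : ℝ) / k.factorial * t ^ k := by
  simp [laguerre, Polynomial.eval_finsetSum]

theorem laguerre_zero : laguerre 0 = 1 := by
  simp [laguerre]

theorem eval_zero_laguerre (n : ℕ) : (laguerre n).eval 0 = 1 := by
  rw [← Polynomial.coeff_zero_eq_eval_zero, coeff_laguerre]
  simp

/-- Compared coefficientwise through Pascal's rule. Together with `derivative_laguerre_succ` it
yields the differential equation, and alone it makes the Newton-Laguerre sums telescope. -/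
theorem X_mul_derivative_laguerre (n : ℕ) :
    Polynomial.X * Polynomial.derivative (laguerre (n + 1)) =
      Polynomial.C (n + 1 : ℝ) * (laguerre (n + 1) - laguerre n) := by
  ext k
  rcases k with _ | k
  · simp [coeff_laguerre]
  · rw [Polynomial.coeff_X_mul, Polynomial.coeff_derivative, Polynomial.coeff_C_mul,
      Polynomial.coeff_sub, coeff_laguerre, coeff_laguerre]
    have h1 : ((n + 1).choose (k + 1) : ℝ) = n.choose k + n.choose (k + 1) := by
      exact_mod_cast Nat.choose_succ_succ n k
    have h2 : ((n : ℝ) + 1) * n.choose k = (n + 1).choose (k + 1) * (k + 1) := by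
      exact_mod_cast Nat.add_one_mul_choose_eq n k
    have h3 : (n.choose (k + 1) : ℝ) = (n + 1).choose (k + 1) - n.choose k := by linarith
    rw [h3]
    field_simp
    linarith

theorem derivative_laguerre_succ (n : ℕ) :
    Polynomial.derivative (laguerre (n + 1)) =
      Polynomial.derivative (laguerre n) - laguerre n := by
  ext k
  rw [Polynomial.coeff_derivative, Polynomial.coeff_sub, Polynomial.coeff_derivative,
    coeff_laguerre, coeff_laguerre, coeff_laguerre, Nat.choose_succ_succ, Nat.factorial_succ]
  have := k.factorial_ne_zero
  push_cast
  field_simp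
  ring

/-- Laguerre's differential equation. -/
theorem laguerre_ode (n : ℕ) :
    Polynomial.X * Polynomial.derivative (Polynomial.derivative (laguerre n)) +
      (1 - Polynomial.X) * Polynomial.derivative (laguerre n) +
      Polynomial.C (n : ℝ) * laguerre n = 0 := by
  rcases n with _ | n
  · simp [laguerre_zero]
  · have h := congrArg Polynomial.derivative (X_mul_derivative_laguerre n)
    have h' := derivative_laguerre_succ n
    have h'' := X_mul_derivative_laguerre n
    rw [Polynomial.derivative_mul, Polynomial.derivative_C_mul, Polynomial.derivative_sub,
      Polynomial.derivative_X] at h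
    push_cast
    linear_combination h - h'' + Polynomial.C (n + 1 : ℝ) * h'

/-- The energy `e^(-2t) (n L² + t L'²)` is nonincreasing and equals `n` at `t = 0`. It bounds `L_n`
uniformly in `n` and `L_n'` up to `√n`. -/
theorem laguerre_energy_le (n : ℕ) {t : ℝ} (ht : 0 ≤ t) :
    n * (laguerre n).eval t ^ 2 + t * (Polynomial.derivative (laguerre n)).eval t ^ 2 ≤
      n * Real.exp t ^ 2 := by
  set L := laguerre n
  set L' := Polynomial.derivative L
  set L'' := Polynomial.derivative L'
  let E : ℝ → ℝ := fun t => Real.exp (-2 * t) * (n * L.eval t ^ 2 + t * L'.eval t ^ 2)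
  have hE : ∀ t, HasDerivAt E (-Real.exp (-2 * t) * (L'.eval t ^ 2 + 2 * n * L.eval t ^ 2)) t := by
    intro t
    have h1 : HasDerivAt (fun t : ℝ => Real.exp (-2 * t)) (Real.exp (-2 * t) * (-2 * 1)) t :=
      ((hasDerivAt_id t).const_mul (-2)).exp
    have h := h1.mul ((((L.hasDerivAt t).pow 2).const_mul (n : ℝ)).add
      ((hasDerivAt_id t).mul ((L'.hasDerivAt t).pow 2)))
    refine h.congr_deriv ?_
    have ode := congrArg (Polynomial.eval t) (laguerre_ode n)
    simp only [Polynomial.eval_add, Polynomial.eval_mul, Polynomial.eval_X, Polynomial.eval_C,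
      Polynomial.eval_sub, Polynomial.eval_one, Polynomial.eval_zero] at ode
    simp only [id, Pi.pow_apply, Pi.mul_apply, Pi.add_apply]
    push_cast
    -- Laguerre's equation replaces `t L''`; the cross terms `L L'` then cancel and a negative sum
    -- of squares remains.
    linear_combination 2 * Real.exp (-2 * t) * L'.eval t * ode
  have hanti : Antitone E := antitone_of_hasDerivAt_nonpos hE fun t => by
    have : 0 ≤ Real.exp (-2 * t) * (L'.eval t ^ 2 + 2 * n * L.eval t ^ 2) := by positivity
    simp only [Pi.zero_apply]
    linarith
  have h0 : E t ≤ E 0 := hanti ht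
  have h1 : E 0 = n := by simp [E, L, eval_zero_laguerre]
  have h2 : Real.exp t ^ 2 * E t = n * L.eval t ^ 2 + t * L'.eval t ^ 2 := by
    simp only [E]
    rw [← mul_assoc, ← Real.exp_nat_mul, ← Real.exp_add]
    simp
  rw [← h2, mul_comm]
  exact mul_le_mul_of_nonneg_right (h0.trans_eq h1) (by positivity)

theorem abs_eval_laguerre_le (n : ℕ) {t : ℝ} (ht : 0 ≤ t) :
    |(laguerre n).eval t| ≤ Real.exp t := by
  rcases n.eq_zero_or_pos with rfl | hn
  · simpa [laguerre_zero] using ht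
  · have h := laguerre_energy_le n ht
    have hn' : (0 : ℝ) < n := by exact_mod_cast hn
    refine abs_le_of_sq_le_sq ?_ (Real.exp_pos t).le
    have : 0 ≤ t * (Polynomial.derivative (laguerre n)).eval t ^ 2 := by positivity
    exact le_of_mul_le_mul_left (by linarith) hn'

theorem abs_eval_derivative_laguerre_le (n : ℕ) {t : ℝ} (ht : 0 < t) :
    |(Polynomial.derivative (laguerre n)).eval t| ≤
      Real.sqrt n * Real.exp t * t ^ (-(1 / 2) : ℝ) := by
  have h := laguerre_energy_le n ht.le
  have h2 : (t ^ (-(1 / 2) : ℝ)) ^ 2 = t⁻¹ := by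
    rw [← Real.rpow_natCast, ← Real.rpow_mul ht.le, ← Real.rpow_neg_one]
    norm_num
  refine abs_le_of_sq_le_sq ?_ (by positivity)
  rw [mul_pow, mul_pow, Real.sq_sqrt (Nat.cast_nonneg n), h2, ← div_eq_mul_inv, le_div_iff₀ ht]
  have : 0 ≤ (n : ℝ) * (laguerre n).eval t ^ 2 := by positivity
  linarith

/-- With the moments `k! / 2^(k+1)` the factorials cancel and the binomial expansion of `(1 - 1/2)^n
/ 2` is left. -/
theorem integral_exp_mul_laguerre (n : ℕ) :
    ∫ t in Ioi (0 : ℝ), Real.exp (-(2 * t)) * (laguerre n).eval t = (1 / 2) ^ (n + 1) := by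
  have hm : ∀ k : ℕ, ∫ t in Ioi (0 : ℝ), Real.exp (-(2 * t)) * t ^ k =
      k.factorial * (1 / 2) ^ (k + 1) := by
    intro k
    have h := Real.integral_rpow_mul_exp_neg_mul_Ioi (a := k + 1) (r := 2) (by positivity) two_pos
    rw [Real.Gamma_nat_eq_factorial] at h
    have h2 : ((1 : ℝ) / 2) ^ ((k : ℝ) + 1) = (1 / 2) ^ (k + 1) := by
      exact_mod_cast Real.rpow_natCast (1 / 2 : ℝ) (k + 1)
    rw [h2] at h
    rw [mul_comm, ← h]
    refine setIntegral_congr_fun measurableSet_Ioi fun t ht => ?_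
    simp only [add_sub_cancel_right, Real.rpow_natCast]
    ring
  have hi : ∀ k : ℕ, IntegrableOn (fun t : ℝ => Real.exp (-(2 * t)) * t ^ k) (Ioi 0) := by
    intro k
    refine Integrable.of_integral_ne_zero ?_
    rw [hm]
    positivity
  have he : ∀ t : ℝ, Real.exp (-(2 * t)) * (laguerre n).eval t =
      ∑ k ∈ Finset.range (n + 1), (-1) ^ k * (n.choose k : ℝ) / k.factorial *
        (Real.exp (-(2 * t)) * t ^ k) := by
    intro t
    rw [eval_laguerre, Finset.mul_sum]
    exact Finset.sum_congr rfl fun k _ => by ring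
  simp only [he]
  rw [integral_finsetSum _ fun k _ => (hi k).const_mul _]
  simp only [integral_const_mul, hm]
  have hb := add_pow (-(1 / 2) : ℝ) 1 n
  rw [pow_succ, show (1 / 2 : ℝ) ^ n = (-(1 / 2) + 1) ^ n by norm_num, hb, Finset.sum_mul]
  refine Finset.sum_congr rfl fun k _ => ?_
  have := k.factorial_ne_zero
  rw [show (-(1 / 2) : ℝ) ^ k = (-1) ^ k * (1 / 2) ^ k by rw [← mul_pow]; norm_num]
  field_simp
  ring


/-! ### The Newton coefficients -/

theorem pochhammerNewton_zero (α : ℂ) : pochhammerNewton 0 α = 1 := by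
  simp [pochhammerNewton]

theorem pochhammerNewton_succ (n : ℕ) (α : ℂ) :
    (n + 1) * pochhammerNewton (n + 1) α = (n - α) * pochhammerNewton n α := by
  have h1 : (n.factorial : ℂ) ≠ 0 := by exact_mod_cast n.factorial_ne_zero
  have h2 : (n : ℂ) + 1 ≠ 0 := by exact_mod_cast n.succ_ne_zero
  rw [pochhammerNewton, pochhammerNewton, Finset.prod_range_succ, Nat.factorial_succ]
  push_cast
  field_simp
  ring

theorem add_one_mul_choose_succ (α : ℂ) (n : ℕ) :
    (n + 1) * Ring.choose α (n + 1) = (α - n) * Ring.choose α n := by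
  have h1 := Ring.descPochhammer_eq_factorial_smul_choose α (n + 1)
  have h2 := Ring.descPochhammer_eq_factorial_smul_choose α n
  rw [descPochhammer_succ_right, Polynomial.smeval_mul, h2, Nat.factorial_succ] at h1
  simp only [Polynomial.smeval_sub, Polynomial.smeval_X, Polynomial.smeval_natCast,
    nsmul_eq_mul, pow_one, pow_zero, mul_one] at h1
  have h3 : (n.factorial : ℂ) ≠ 0 := by exact_mod_cast n.factorial_ne_zero
  push_cast at h1
  apply mul_left_cancel₀ h3
  linear_combination -h1

theorem pochhammerNewton_eq_choose (n : ℕ) (α : ℂ) :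
    pochhammerNewton n α = (-1) ^ n * Ring.choose α n := by
  induction n with
  | zero => simp [pochhammerNewton]
  | succ n ih =>
    have h : (n : ℂ) + 1 ≠ 0 := by exact_mod_cast n.succ_ne_zero
    apply mul_left_cancel₀ h
    rw [pochhammerNewton_succ, ih, pow_succ]
    linear_combination (-1) ^ n * add_one_mul_choose_succ α n

theorem pochhammerNewton_natCast (k n : ℕ) :
    pochhammerNewton k (n : ℂ) = (-1) ^ k * (n.choose k : ℂ) := by
  rw [pochhammerNewton_eq_choose, Ring.choose_natCast]

/-- Relates the coefficients to Gauss's product for `1/Γ(-α)`, from which their decay is read off.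
The identity also holds when the product vanishes, since then both sides are `0`. -/
theorem pochhammerNewton_succ_eq_inv_gammaSeq (α : ℂ) {n : ℕ} (hn : n ≠ 0) :
    (n + 1) * pochhammerNewton (n + 1) α = (n : ℂ) ^ (-α) * (Complex.GammaSeq (-α) n)⁻¹ := by
  have h1 : (n.factorial : ℂ) ≠ 0 := by exact_mod_cast n.factorial_ne_zero
  have h2 : (n : ℂ) + 1 ≠ 0 := by exact_mod_cast n.succ_ne_zero
  have h3 : (n : ℂ) ^ (-α) ≠ 0 := by
    rw [Ne, Complex.cpow_eq_zero_iff]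
    simp [hn]
  have h4 : ∏ j ∈ Finset.range (n + 1), (-α + j) =
      (-1) ^ (n + 1) * ∏ j ∈ Finset.range (n + 1), (α - j) := by
    conv_rhs => rw [← Finset.card_range (n + 1), ← Finset.prod_const, Finset.card_range,
      ← Finset.prod_mul_distrib]
    exact Finset.prod_congr rfl fun j _ => by ring
  rw [Complex.GammaSeq, h4, pochhammerNewton, Nat.factorial_succ, inv_div]
  push_cast
  field_simp

theorem exists_norm_pochhammerNewton_le {α : ℂ} (hα : 0 < α.re) :
    ∃ C : ℝ, 0 < C ∧ ∀ n : ℕ, 1 ≤ n → ‖pochhammerNewton n α‖ ≤ C * (n : ℝ) ^ (-(1 + α.re)) := by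
  obtain ⟨B, hB⟩ : ∃ B : ℝ, ∀ n : ℕ, ‖(Complex.GammaSeq (-α) n)⁻¹‖ ≤ B := by
    suffices h : ∃ l, Tendsto (fun n => (Complex.GammaSeq (-α) n)⁻¹) atTop (𝓝 l) by
      obtain ⟨l, hl⟩ := h
      obtain ⟨B, hB⟩ := (Metric.isBounded_range_of_tendsto _ hl).exists_norm_le
      exact ⟨B, fun n => hB _ (mem_range_self n)⟩
    -- For natural `α` the denominator of `GammaSeq` contains a zero factor once `n ≥ m`, so the
    -- inverse is eventually `0`; otherwise `Γ(-α) ≠ 0` and the limit can be inverted.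
    by_cases hm : ∃ m : ℕ, -α = -(m : ℂ)
    · obtain ⟨m, hm⟩ := hm
      refine ⟨0, tendsto_const_nhds.congr' ?_⟩
      filter_upwards [eventually_ge_atTop m] with n hn
      rw [Complex.GammaSeq, Finset.prod_eq_zero (Finset.mem_range.2 (Nat.lt_succ_of_le hn))]
      · simp
      · rw [hm]; ring
    · push Not at hm
      exact ⟨_, (Complex.GammaSeq_tendsto_Gamma (-α)).inv₀ (Complex.Gamma_ne_zero hm)⟩
  have hB0 : 0 ≤ B := (norm_nonneg _).trans (hB 0)
  -- The factor `2 ^ α.re` comes from `n + 1 ≤ 2n`; the second term covers index `1`, where the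
  -- product formula is not available; the `1` ensures positivity.
  refine ⟨2 ^ α.re * B + ‖pochhammerNewton 1 α‖ + 1, by positivity, fun n hn => ?_⟩
  obtain ⟨n, rfl⟩ := Nat.exists_eq_add_of_le' hn
  rcases n.eq_zero_or_pos with rfl | hpos
  · simp only [zero_add, Nat.cast_one, Real.one_rpow, mul_one]
    have : 0 ≤ (2 : ℝ) ^ α.re * B := by positivity
    linarith
  · have hn0 : (0 : ℝ) < n := by exact_mod_cast hpos
    have h := congrArg norm (pochhammerNewton_succ_eq_inv_gammaSeq α hpos.ne')
    rw [norm_mul, norm_mul, Complex.norm_natCast_cpow_of_pos hpos, Complex.neg_re] at h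
    have h2 : ‖(n : ℂ) + 1‖ = n + 1 := by
      rw [← Nat.cast_succ, Complex.norm_natCast, Nat.cast_succ]
    have h3 : (n : ℝ) ^ (-α.re) ≤ 2 ^ α.re * ((n : ℝ) + 1) ^ (-α.re) := by
      rw [Real.rpow_neg hn0.le, Real.rpow_neg (by positivity), ← div_eq_mul_inv,
        ← Real.div_rpow (by norm_num) (by positivity), ← Real.inv_rpow hn0.le]
      refine Real.rpow_le_rpow (by positivity) ?_ hα.le
      have : (1 : ℝ) ≤ n := by exact_mod_cast hpos
      rw [inv_le_iff_one_le_mul₀ hn0]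
      field_simp
      linarith
    have h4 : ((n : ℝ) + 1) * ((n : ℝ) + 1) ^ (-(1 + α.re)) = ((n : ℝ) + 1) ^ (-α.re) := by
      rw [neg_add, Real.rpow_add (by positivity), Real.rpow_neg_one,
        mul_inv_cancel_left₀ (by positivity)]
    have h5 : 0 ≤ ((n : ℝ) + 1) ^ (-(1 + α.re)) := by positivity
    push_cast
    rw [h2] at h
    have key : ((n : ℝ) + 1) * ‖pochhammerNewton (n + 1) α‖ ≤
        ((n : ℝ) + 1) * (2 ^ α.re * B * ((n : ℝ) + 1) ^ (-(1 + α.re))) := by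
      rw [h]
      calc _ ≤ (2 ^ α.re * ((n : ℝ) + 1) ^ (-α.re)) * B :=
            mul_le_mul h3 (hB n) (norm_nonneg _) (by positivity)
        _ = _ := by rw [← h4]; ring
    refine (le_of_mul_le_mul_left key (by positivity)).trans ?_
    refine mul_le_mul_of_nonneg_right ?_ h5
    linarith [norm_nonneg (pochhammerNewton 1 α)]

theorem summable_norm_pochhammerNewton {α : ℂ} (hα : 0 < α.re) :
    Summable fun n => ‖pochhammerNewton n α‖ := by
  obtain ⟨C, -, hC⟩ := exists_norm_pochhammerNewton_le hα
  have h : Summable fun n : ℕ => C * (n : ℝ) ^ (-(1 + α.re)) :=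
    (Real.summable_nat_rpow.2 (by linarith)).mul_left C
  refine Summable.of_norm_bounded_eventually_nat h ?_
  filter_upwards [eventually_ge_atTop 1] with n hn
  rw [norm_norm]
  exact hC n hn

/-- Decay of the coefficients and of the tails of the Newton series. -/
theorem exists_newton_decay {α : ℂ} (hα : 0 < α.re) :
    ∃ C : ℝ, 0 < C ∧ ∀ N : ℕ, 1 ≤ N →
      ‖N * pochhammerNewton N α‖ ≤ C * (N : ℝ) ^ (-(α.re / 2)) ∧
      ∑' n, ‖pochhammerNewton (n + N) α‖ ≤ C * (N : ℝ) ^ (-(α.re / 2)) := by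
  obtain ⟨C, hC0, hC⟩ := exists_norm_pochhammerNewton_le hα
  have hs : Summable fun n : ℕ => (n : ℝ) ^ (-(1 + α.re / 2)) :=
    Real.summable_nat_rpow.2 (by linarith)
  set S := ∑' n : ℕ, (n : ℝ) ^ (-(1 + α.re / 2))
  have hS : 0 ≤ S := tsum_nonneg fun n => by positivity
  refine ⟨C * (S + 1), by positivity, fun N hN => ?_⟩
  have hN0 : (0 : ℝ) < N := by exact_mod_cast hN
  have hN1 : (1 : ℝ) ≤ N := by exact_mod_cast hN
  constructor
  · rw [norm_mul, Complex.norm_natCast]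
    calc (N : ℝ) * ‖pochhammerNewton N α‖ ≤ N * (C * (N : ℝ) ^ (-(1 + α.re))) :=
          mul_le_mul_of_nonneg_left (hC N hN) hN0.le
      _ = C * (N : ℝ) ^ (-α.re) := by
          rw [neg_add, Real.rpow_add hN0, Real.rpow_neg_one]
          field_simp
      _ ≤ C * (N : ℝ) ^ (-(α.re / 2)) := by
          refine mul_le_mul_of_nonneg_left ?_ hC0.le
          exact Real.rpow_le_rpow_of_exponent_le hN1 (by linarith)
      _ ≤ _ := by
          refine mul_le_mul_of_nonneg_right ?_ (by positivity)
          nlinarith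
  · have hs' := (summable_nat_add_iff N).2 hs
    calc ∑' n, ‖pochhammerNewton (n + N) α‖
        ≤ ∑' n : ℕ, C * (N : ℝ) ^ (-(α.re / 2)) * ((n + N : ℕ) : ℝ) ^ (-(1 + α.re / 2)) := by
          refine Summable.tsum_le_tsum (fun n => (hC (n + N) (by omega)).trans ?_)
            ((summable_nat_add_iff N).2 (summable_norm_pochhammerNewton hα)) (hs'.mul_left _)
          have hp : (0 : ℝ) < ((n + N : ℕ) : ℝ) := by exact_mod_cast (by omega : 0 < n + N)
          -- Half of the excess decay is kept as a rate in `N`, the other half makes the tail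
          -- summable.
          rw [show -(1 + α.re) = -(α.re / 2) + -(1 + α.re / 2) by ring, Real.rpow_add hp,
            mul_assoc]
          gcongr C * (?_ * _)
          refine Real.rpow_le_rpow_of_nonpos hN0 ?_ (by linarith)
          exact_mod_cast (by omega : N ≤ n + N)
      _ = C * (N : ℝ) ^ (-(α.re / 2)) * ∑' n : ℕ, ((n + N : ℕ) : ℝ) ^ (-(1 + α.re / 2)) :=
          tsum_mul_left
      _ ≤ C * (N : ℝ) ^ (-(α.re / 2)) * S := by
          refine mul_le_mul_of_nonneg_left ?_ (by positivity)
          have := hs.sum_add_tsum_nat_add N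
          rw [show S = _ from this.symm]
          exact le_add_of_nonneg_left (Finset.sum_nonneg fun _ _ => by positivity)
      _ ≤ _ := by
          have : 0 ≤ C * (N : ℝ) ^ (-(α.re / 2)) := by positivity
          linarith

theorem tendsto_natCast_mul_pochhammerNewton {α : ℂ} (hα : 0 < α.re) :
    Tendsto (fun N : ℕ => ‖(N : ℂ) * pochhammerNewton N α‖) atTop (𝓝 0) := by
  obtain ⟨C, -, hC⟩ := exists_newton_decay hα
  have h : Tendsto (fun N : ℕ => C * (N : ℝ) ^ (-(α.re / 2))) atTop (𝓝 (C * 0)) :=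
    ((tendsto_rpow_neg_atTop (by positivity)).comp tendsto_natCast_atTop_atTop).const_mul C
  rw [mul_zero] at h
  refine squeeze_zero' (Eventually.of_forall fun _ => norm_nonneg _) ?_ h
  filter_upwards [eventually_ge_atTop 1] with N hN using (hC N hN).1

/-! ### The Newton-Laguerre sums -/

/-- The partial sums of `∑_n P_n(α) L_n(t)`. -/
def newtonLaguerre (α : ℂ) (N : ℕ) (t : ℝ) : ℂ :=
  ∑ n ∈ Finset.range N, pochhammerNewton n α * ((laguerre n).eval t : ℝ)

/-- The derivatives of the partial sums of `∑_n P_n(α) L_n(t)`. -/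
def newtonLaguerreDeriv (α : ℂ) (N : ℕ) (t : ℝ) : ℂ :=
  ∑ n ∈ Finset.range N,
    pochhammerNewton n α * ((Polynomial.derivative (laguerre n)).eval t : ℝ)

theorem hasDerivAt_newtonLaguerre (α : ℂ) (N : ℕ) (t : ℝ) :
    HasDerivAt (newtonLaguerre α N) (newtonLaguerreDeriv α N t) t := by
  unfold newtonLaguerre newtonLaguerreDeriv
  exact HasDerivAt.fun_sum fun n _ => ((laguerre n).hasDerivAt t).ofReal_comp.const_mul _

/-- The sums solve `t S' = α S` up to one boundary term: `t L_(n+1)' = (n+1)(L_(n+1) - L_n)` and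
`(n+1) P_(n+1) = (n - α) P_n` telescope. -/
theorem mul_newtonLaguerreDeriv (α : ℂ) (N : ℕ) (t : ℝ) :
    t * newtonLaguerreDeriv α (N + 1) t = α * newtonLaguerre α (N + 1) t +
      (N + 1 : ℕ) * pochhammerNewton (N + 1) α * ((laguerre N).eval t : ℝ) := by
  induction N with
  | zero =>
    have := pochhammerNewton_succ 0 α
    simp only [pochhammerNewton_zero] at this
    simp [newtonLaguerreDeriv, newtonLaguerre, laguerre_zero, pochhammerNewton_zero]
    simp at this
    rw [this]
    ring
  | succ N ih =>
    have h1 : newtonLaguerreDeriv α (N + 1 + 1) t = newtonLaguerreDeriv α (N + 1) t +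
        pochhammerNewton (N + 1) α *
          ((Polynomial.derivative (laguerre (N + 1))).eval t : ℝ) := Finset.sum_range_succ _ _
    have h2 : newtonLaguerre α (N + 1 + 1) t = newtonLaguerre α (N + 1) t +
        pochhammerNewton (N + 1) α * ((laguerre (N + 1)).eval t : ℝ) := Finset.sum_range_succ _ _
    have h3 := congrArg (Polynomial.eval t) (X_mul_derivative_laguerre N)
    simp only [Polynomial.eval_mul, Polynomial.eval_X, Polynomial.eval_C,
      Polynomial.eval_sub] at h3
    have h4 := congrArg (fun x : ℝ => (x : ℂ)) h3
    have h5 := pochhammerNewton_succ (N + 1) α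
    push_cast at h4 h5 ih ⊢
    rw [h1, h2]
    linear_combination ih + pochhammerNewton (N + 1) α * h4 -
      ((laguerre (N + 1)).eval t : ℝ) * h5

/-- The telescoped equation at `t = 0`, where every `L_n` equals `1`. It shows that the identity
part of the Newton sums tends to `0`. -/
theorem sum_pochhammerNewton (α : ℂ) (N : ℕ) :
    α * ∑ n ∈ Finset.range (N + 1), pochhammerNewton n α =
      -((N + 1 : ℕ) * pochhammerNewton (N + 1) α) := by
  have h := mul_newtonLaguerreDeriv α N 0
  simp only [newtonLaguerre, eval_zero_laguerre, Complex.ofReal_zero, zero_mul,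
    Complex.ofReal_one, mul_one] at h
  linear_combination -h

theorem tendsto_sum_pochhammerNewton {α : ℂ} (hα : 0 < α.re) :
    Tendsto (fun N => ‖∑ n ∈ Finset.range N, pochhammerNewton n α‖) atTop (𝓝 0) := by
  rw [← tendsto_add_atTop_iff_nat 1]
  have hα0 : α ≠ 0 := fun h => by simp [h] at hα
  have h := ((tendsto_add_atTop_iff_nat 1).2
    (tendsto_natCast_mul_pochhammerNewton hα)).const_mul ‖α‖⁻¹
  rw [mul_zero] at h
  refine h.congr fun N => ?_
  rw [← norm_neg (_ * _), ← sum_pochhammerNewton, norm_mul,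
    inv_mul_cancel_left₀ (norm_ne_zero_iff.2 hα0)]

theorem summable_norm_newton_laguerre {α : ℂ} (hα : 0 < α.re) {t : ℝ} (ht : 0 ≤ t) :
    Summable fun n => ‖pochhammerNewton n α * ((laguerre n).eval t : ℝ)‖ := by
  refine Summable.of_nonneg_of_le (fun _ => norm_nonneg _) (fun n => ?_)
    ((summable_norm_pochhammerNewton hα).mul_right (Real.exp t))
  rw [norm_mul, Complex.norm_real]
  exact mul_le_mul_of_nonneg_left (abs_eval_laguerre_le n ht) (norm_nonneg _)

/-- The sum of the series `∑_n P_n(α) L_n(t)`. -/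
def newtonLaguerreSum (α : ℂ) (t : ℝ) : ℂ :=
  ∑' n, pochhammerNewton n α * ((laguerre n).eval t : ℝ)

theorem tendsto_newtonLaguerre {α : ℂ} (hα : 0 < α.re) {t : ℝ} (ht : 0 ≤ t) :
    Tendsto (fun N => newtonLaguerre α N t) atTop (𝓝 (newtonLaguerreSum α t)) :=
  (summable_norm_newton_laguerre hα ht).of_norm.hasSum.tendsto_sum_nat

theorem norm_newtonLaguerre_sub_le {α : ℂ} (hα : 0 < α.re) {t : ℝ} (ht : 0 ≤ t) (N : ℕ) :
    ‖newtonLaguerre α N t - newtonLaguerreSum α t‖ ≤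
      (∑' n, ‖pochhammerNewton (n + N) α‖) * Real.exp t := by
  have hs := summable_norm_newton_laguerre hα ht
  rw [newtonLaguerreSum, ← hs.of_norm.sum_add_tsum_nat_add N, newtonLaguerre, sub_add_cancel_left,
    norm_neg, ← tsum_mul_right]
  have hs' := (summable_nat_add_iff N).2 hs
  refine (norm_tsum_le_tsum_norm hs').trans (hs'.tsum_le_tsum (fun n => ?_)
    (((summable_nat_add_iff N).2 (summable_norm_pochhammerNewton hα)).mul_right _))
  rw [norm_mul, Complex.norm_real]
  exact mul_le_mul_of_nonneg_left (abs_eval_laguerre_le _ ht) (norm_nonneg _)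

theorem hasDerivAt_cpow_mul_newtonLaguerre (α : ℂ) (N : ℕ) {t : ℝ} (ht : 0 < t) :
    HasDerivAt (fun t : ℝ => (t : ℂ) ^ (-α) * newtonLaguerre α (N + 1) t)
      ((N + 1 : ℕ) * pochhammerNewton (N + 1) α * (t : ℂ) ^ (-α - 1) *
        ((laguerre N).eval t : ℝ)) t := by
  have h1 : HasDerivAt (fun t : ℝ => (t : ℂ) ^ (-α)) (-α * (t : ℂ) ^ (-α - 1) * 1) t :=
    ((hasDerivAt_id (t : ℂ)).cpow_const (Or.inl (by simpa using ht))).comp_ofReal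
  refine (h1.mul (hasDerivAt_newtonLaguerre α (N + 1) t)).congr_deriv ?_
  have ht' : (t : ℂ) ≠ 0 := by exact_mod_cast ht.ne'
  have h2 : (t : ℂ) ^ (-α) = (t : ℂ) ^ (-α - 1) * t := by
    rw [Complex.cpow_sub _ _ ht', Complex.cpow_one, div_mul_cancel₀ _ ht']
  rw [h2]
  linear_combination (t : ℂ) ^ (-α - 1) * mul_newtonLaguerreDeriv α N t

/-- The derivative of `t^(-α) S_N(t)` is only the boundary term, which tends to `0` uniformly
between `1` and `t`; so `t^(-α)` times the limit is constant. -/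
theorem newtonLaguerreSum_eq_mul_cpow {α : ℂ} (hα : 0 < α.re) {t : ℝ} (ht : 0 < t) :
    newtonLaguerreSum α t = newtonLaguerreSum α 1 * (t : ℂ) ^ α := by
  have ht' : (t : ℂ) ≠ 0 := by exact_mod_cast ht.ne'
  -- Bounds `|s^(-α-1) L_N(s)|` for all `s` between `1` and `t`.
  set B := (min 1 t) ^ (-α.re - 1) * Real.exp (max 1 t)
  have hm : 0 < min 1 t := lt_min one_pos ht
  have hbound : ∀ N : ℕ, ‖(t : ℂ) ^ (-α) * newtonLaguerre α (N + 1) t -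
      newtonLaguerre α (N + 1) 1‖ ≤
        ‖((N + 1 : ℕ) : ℂ) * pochhammerNewton (N + 1) α‖ * B * ‖t - 1‖ := by
    intro N
    have h := Convex.norm_image_sub_le_of_norm_hasDerivWithin_le (s := uIcc 1 t)
      (C := ‖((N + 1 : ℕ) : ℂ) * pochhammerNewton (N + 1) α‖ * B)
      (fun s hs => (hasDerivAt_cpow_mul_newtonLaguerre α N
        (hm.trans_le hs.1)).hasDerivWithinAt) (fun s hs => ?_) (convex_uIcc 1 t)
      left_mem_uIcc right_mem_uIcc
    · simpa using h
    · have hs0 : 0 < s := hm.trans_le hs.1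
      rw [norm_mul, norm_mul, mul_assoc, Complex.norm_cpow_eq_rpow_re_of_pos hs0,
        Complex.norm_real]
      refine mul_le_mul_of_nonneg_left ?_ (norm_nonneg _)
      refine mul_le_mul ?_ ((abs_eval_laguerre_le N hs0.le).trans (Real.exp_le_exp.2 hs.2))
        (norm_nonneg _) (by positivity)
      simp only [Complex.sub_re, Complex.neg_re, Complex.one_re]
      exact Real.rpow_le_rpow_of_nonpos hm hs.1 (by linarith)
  have h0 : Tendsto (fun N : ℕ => ‖((N + 1 : ℕ) : ℂ) * pochhammerNewton (N + 1) α‖ * B *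
      ‖t - 1‖) atTop (𝓝 (0 * B * ‖t - 1‖)) :=
    (((tendsto_add_atTop_iff_nat 1).2
      (tendsto_natCast_mul_pochhammerNewton hα)).mul_const B).mul_const _
  rw [zero_mul, zero_mul] at h0
  have h1 := squeeze_zero_norm hbound h0
  have h2 := (((tendsto_add_atTop_iff_nat 1).2 (tendsto_newtonLaguerre hα ht.le)).const_mul
    ((t : ℂ) ^ (-α))).sub ((tendsto_add_atTop_iff_nat 1).2
      (tendsto_newtonLaguerre hα (zero_le_one (α := ℝ))))
  have h3 := sub_eq_zero.1 (tendsto_nhds_unique h2 h1)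
  rw [← h3, Complex.cpow_neg]
  have : (t : ℂ) ^ α ≠ 0 := by
    rw [Ne, Complex.cpow_eq_zero_iff]
    simp [ht']
  field_simp

theorem hasSum_pochhammerNewton_mul_half_pow (α : ℂ) :
    HasSum (fun n => pochhammerNewton n α * (1 / 2) ^ n) ((1 / 2 : ℂ) ^ α) := by
  have h := (Complex.one_add_cpow_hasFPowerSeriesOnBall_zero (a := α)).hasSum
    (y := (-(1 / 2) : ℂ)) (by
      rw [← ENNReal.ofReal_one, Metric.eball_ofReal]
      simp
      norm_num)
  simp only [binomialSeries_apply, List.ofFn_const, List.prod_replicate, zero_add,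
    smul_eq_mul] at h
  rw [show (1 : ℂ) + -(1 / 2) = 1 / 2 by norm_num] at h
  refine h.congr_fun fun n => ?_
  rw [pochhammerNewton_eq_choose, neg_pow (1 / 2 : ℂ)]
  ring

/-- The constant is found by a Laplace transform at `2`: termwise it is `½ ∑ P_n(α) 2^(-n) =
2^(-α-1)` by the binomial series, and for a multiple of `t^α` it is that multiple of `Γ(α+1)
2^(-α-1)`. At `2` the bound `|L_n| ≤ e^t` leaves the integrable majorant `e^(-t)`. -/
theorem newtonLaguerreSum_one {α : ℂ} (hα : 0 < α.re) :
    newtonLaguerreSum α 1 = (Complex.Gamma (α + 1))⁻¹ := by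
  have hint : ∀ n : ℕ, IntegrableOn (fun t : ℝ => Complex.exp (-(2 * t)) *
      (pochhammerNewton n α * ((laguerre n).eval t : ℝ))) (Ioi 0) ∧
      ∫ t in Ioi (0 : ℝ), ‖Complex.exp (-(2 * t)) *
        (pochhammerNewton n α * ((laguerre n).eval t : ℝ))‖ ≤ ‖pochhammerNewton n α‖ := by
    intro n
    have hb : ∀ t ∈ Ioi (0 : ℝ), ‖Complex.exp (-(2 * t)) *
        (pochhammerNewton n α * ((laguerre n).eval t : ℝ))‖ ≤
        ‖pochhammerNewton n α‖ * Real.exp (-t) := by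
      intro t ht
      have h1 := abs_eval_laguerre_le n (le_of_lt ht)
      have h2 : Real.exp (-t) = Real.exp (-(2 * t)) * Real.exp t := by
        rw [← Real.exp_add]; ring_nf
      rw [norm_mul, norm_mul, Complex.norm_real, Complex.norm_exp, h2]
      simp only [Complex.neg_re, Complex.mul_re, Complex.re_ofNat, Complex.ofReal_re,
        Complex.im_ofNat, Complex.ofReal_im, mul_zero, sub_zero]
      rw [mul_left_comm]
      gcongr
      exact h1
    have hi := (integrableOn_exp_neg_Ioi 0).const_mul ‖pochhammerNewton n α‖
    have hi' : IntegrableOn (fun t : ℝ => Complex.exp (-(2 * t)) *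
      (pochhammerNewton n α * ((laguerre n).eval t : ℝ))) (Ioi 0) := by
      refine Integrable.mono' hi (Continuous.aestronglyMeasurable (by fun_prop)) ?_
      filter_upwards [ae_restrict_mem measurableSet_Ioi] with t ht using hb t ht
    refine ⟨hi', (setIntegral_mono_on hi'.norm hi measurableSet_Ioi hb).trans_eq ?_⟩
    rw [integral_const_mul, integral_exp_neg_Ioi_zero, mul_one]
  have h1 := hasSum_integral_of_summable_integral_norm (fun n => (hint n).1)
    ((summable_norm_pochhammerNewton hα).of_nonneg_of_le
      (fun n => integral_nonneg fun _ => norm_nonneg _) fun n => (hint n).2)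
  have h2 : ∀ n : ℕ, ∫ t in Ioi (0 : ℝ), Complex.exp (-(2 * t)) *
      (pochhammerNewton n α * ((laguerre n).eval t : ℝ)) =
      pochhammerNewton n α * (1 / 2) ^ n * (1 / 2) := by
    intro n
    have h := congrArg (fun x : ℝ => (x : ℂ)) (integral_exp_mul_laguerre n)
    rw [← integral_complex_ofReal] at h
    push_cast at h
    rw [mul_assoc, ← pow_succ, ← h, ← integral_const_mul]
    refine integral_congr_ae (Eventually.of_forall fun t => ?_)
    simp only
    ring
  simp only [h2] at h1
  have h3 := h1.unique ((hasSum_pochhammerNewton_mul_half_pow α).mul_right _)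
  have h4 : ∫ t in Ioi (0 : ℝ), ∑' n, Complex.exp (-(2 * t)) *
      (pochhammerNewton n α * ((laguerre n).eval t : ℝ)) =
      newtonLaguerreSum α 1 * ((1 / 2) ^ (α + 1) * Complex.Gamma (α + 1)) := by
    have hg := Complex.integral_cpow_mul_exp_neg_mul_Ioi (a := α + 1) (r := 2)
      (by simp; linarith) (by simp)
    rw [Complex.ofReal_ofNat] at hg
    rw [← hg, ← integral_const_mul]
    refine setIntegral_congr_fun measurableSet_Ioi fun t ht => ?_
    simp only [add_sub_cancel_right]
    rw [tsum_mul_left, ← newtonLaguerreSum, newtonLaguerreSum_eq_mul_cpow hα ht]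
    ring
  have h5 : (1 / 2 : ℂ) ^ α ≠ 0 := by
    rw [Ne, Complex.cpow_eq_zero_iff]
    simp
  have h6 : Complex.Gamma (α + 1) ≠ 0 := Complex.Gamma_ne_zero_of_re_pos (by simp; linarith)
  rw [h4, Complex.cpow_add _ _ (by norm_num), Complex.cpow_one] at h3
  apply mul_right_cancel₀ h6
  rw [inv_mul_cancel₀ h6]
  apply mul_left_cancel₀ h5
  linear_combination 2 * h3

theorem newtonLaguerreSum_eq {α : ℂ} (hα : 0 < α.re) {t : ℝ} (ht : 0 < t) :
    newtonLaguerreSum α t = (Complex.Gamma (α + 1))⁻¹ * (t : ℂ) ^ α := by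
  rw [newtonLaguerreSum_eq_mul_cpow hα ht, newtonLaguerreSum_one hα]


/-! ### Convergence of the Newton kernels -/

/-- The difference between the derivative of the `N`-th Newton-Laguerre sum and its limit. -/
def newtonDefect (α : ℂ) (N : ℕ) (t : ℝ) : ℂ :=
  newtonLaguerreDeriv α N t - rlKernel α t

/-- Subtracting the exact equation for `t^α / Γ(α+1)` from the telescoped one expresses `t` times
the defect through a tail of the undifferentiated series. The bound decays in `N` but is not
integrable at `0`. -/
theorem norm_newtonDefect_le_div {α : ℂ} (hα : 0 < α.re) (N : ℕ) {t : ℝ} (ht : 0 < t) :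
    ‖newtonDefect α (N + 1) t‖ ≤ (‖α‖ * ∑' n, ‖pochhammerNewton (n + (N + 1)) α‖ +
      ‖((N + 1 : ℕ) : ℂ) * pochhammerNewton (N + 1) α‖) * Real.exp t * t ^ (-1 : ℝ) := by
  have ht' : (t : ℂ) ≠ 0 := by exact_mod_cast ht.ne'
  have hα0 : α ≠ 0 := fun h => by simp [h] at hα
  have key : t * newtonDefect α (N + 1) t =
      α * (newtonLaguerre α (N + 1) t - newtonLaguerreSum α t) +
        (N + 1 : ℕ) * pochhammerNewton (N + 1) α * ((laguerre N).eval t : ℝ) := by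
    have h1 : (t : ℂ) * (t : ℂ) ^ (α - 1) = (t : ℂ) ^ α := by
      rw [Complex.cpow_sub _ _ ht', Complex.cpow_one, mul_div_cancel₀ _ ht']
    have h2 : α * (Complex.Gamma (α + 1))⁻¹ = (Complex.Gamma α)⁻¹ := by
      rw [Complex.Gamma_add_one α hα0, mul_inv, mul_inv_cancel_left₀ hα0]
    rw [newtonDefect, rlKernel, newtonLaguerreSum_eq hα ht, ← h1, ← h2]
    linear_combination mul_newtonLaguerreDeriv α N t
  have h3 := congrArg norm key
  rw [norm_mul, Complex.norm_real, Real.norm_of_nonneg ht.le] at h3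
  rw [Real.rpow_neg_one, ← div_eq_mul_inv, le_div_iff₀ ht, mul_comm, h3, add_mul]
  refine (norm_add_le _ _).trans (add_le_add ?_ ?_)
  · rw [norm_mul, mul_assoc]
    exact mul_le_mul_of_nonneg_left (norm_newtonLaguerre_sub_le hα ht.le _) (norm_nonneg _)
  · rw [norm_mul, Complex.norm_real]
    exact mul_le_mul_of_nonneg_left (abs_eval_laguerre_le N ht.le) (norm_nonneg _)

/-- The complementary bound, from the energy estimate for `L_n'`: integrable at `0`, but growing in
`N`. -/
theorem norm_newtonDefect_le_sqrt {α : ℂ} (hα : 0 < α.re) {N : ℕ} (hN : 1 ≤ N) {t : ℝ}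
    (ht : 0 < t) : ‖newtonDefect α N t‖ ≤
      (∑' n, ‖pochhammerNewton n α‖ + ‖(Complex.Gamma α)⁻¹‖) * (N : ℝ) ^ (1 / 2 : ℝ) *
        Real.exp t * (t ^ (-(1 / 2) : ℝ) + t ^ (α.re - 1)) := by
  have hS : 0 ≤ ∑' n, ‖pochhammerNewton n α‖ := tsum_nonneg fun _ => norm_nonneg _
  have h1 : ‖newtonLaguerreDeriv α N t‖ ≤
      (∑' n, ‖pochhammerNewton n α‖) * (N : ℝ) ^ (1 / 2 : ℝ) * Real.exp t *
        t ^ (-(1 / 2) : ℝ) := by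
    refine (norm_sum_le_of_le (f := fun n => pochhammerNewton n α *
      ((Polynomial.derivative (laguerre n)).eval t : ℝ)) _ (fun n hn => ?_)).trans
      (?_ : ∑ n ∈ Finset.range N, ‖pochhammerNewton n α‖ *
        ((N : ℝ) ^ (1 / 2 : ℝ) * Real.exp t * t ^ (-(1 / 2) : ℝ)) ≤ _)
    · rw [norm_mul, Complex.norm_real]
      refine mul_le_mul_of_nonneg_left ((abs_eval_derivative_laguerre_le n ht).trans ?_)
        (norm_nonneg _)
      rw [← Real.sqrt_eq_rpow]
      have : (n : ℝ) ≤ N := by exact_mod_cast (Finset.mem_range.1 hn).le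
      gcongr
    · rw [← Finset.sum_mul, ← mul_assoc, ← mul_assoc]
      gcongr
      exact (summable_norm_pochhammerNewton hα).sum_le_tsum _ fun _ _ => norm_nonneg _
  have h2 : ‖rlKernel α t‖ ≤ ‖(Complex.Gamma α)⁻¹‖ * (N : ℝ) ^ (1 / 2 : ℝ) * Real.exp t *
      t ^ (α.re - 1) := by
    rw [rlKernel, norm_mul, norm_cpow_sub_one ht, mul_assoc ‖_‖]
    gcongr
    refine le_mul_of_one_le_right (norm_nonneg _) ?_
    have h3 : (1 : ℝ) ≤ (N : ℝ) ^ (1 / 2 : ℝ) :=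
      Real.one_le_rpow (by exact_mod_cast hN) (by norm_num)
    exact one_le_mul_of_one_le_of_one_le h3 (Real.one_le_exp ht.le)
  refine (norm_sub_le _ _).trans ((add_le_add h1 h2).trans ?_)
  have e1 : 0 ≤ (N : ℝ) ^ (1 / 2 : ℝ) * Real.exp t := by positivity
  have e2 : 0 ≤ t ^ (-(1 / 2) : ℝ) := by positivity
  have e3 : 0 ≤ t ^ (α.re - 1) := by positivity
  have e4 := mul_nonneg (mul_nonneg hS e1) e3
  have e5 := mul_nonneg (mul_nonneg (norm_nonneg (Complex.Gamma α)⁻¹) e1) e2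
  nlinarith

theorem rpow_add_le_add_rpow_real {a b p : ℝ} (ha : 0 ≤ a) (hb : 0 ≤ b) (hp : 0 ≤ p)
    (hp1 : p ≤ 1) : (a + b) ^ p ≤ a ^ p + b ^ p := by
  lift a to NNReal using ha
  lift b to NNReal using hb
  exact_mod_cast NNReal.rpow_add_le_add_rpow a b hp hp1

/-- Interpolation between the two preceding bounds. -/
theorem exists_norm_newtonDefect_le {α : ℂ} (hα : 0 < α.re) :
    ∃ C p q : ℝ, 0 ≤ C ∧ 0 < p ∧ 0 < q ∧ ∀ N : ℕ, 1 ≤ N → ∀ t : ℝ, 0 < t →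
      ‖newtonDefect α N t‖ ≤ C * (N : ℝ) ^ (-(α.re / 4)) *
        (Real.exp t * (t ^ (p - 1) + t ^ (q - 1))) := by
  obtain ⟨C, hC0, hC⟩ := exists_newton_decay hα
  set r := α.re
  -- Weight of the growing bound: the exponent of `N` becomes `-(r/2)(1 - θ) + θ/2 = -r/2 + θ(r+1)/2
  -- = -r/4`.
  set θ := r / (2 * (r + 1))
  have hθ0 : 0 < θ := by positivity
  have hθ : θ * (r + 1) = r / 2 := by simp only [θ]; field_simp
  have hθ1 : θ < 1 := by nlinarith
  set C1 := (‖α‖ + 1) * C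
  set C2 := ∑' n, ‖pochhammerNewton n α‖ + ‖(Complex.Gamma α)⁻¹‖
  have hS : 0 ≤ ∑' n, ‖pochhammerNewton n α‖ := tsum_nonneg fun _ => norm_nonneg _
  have hC1 : 0 ≤ C1 := by positivity
  have hC2 : 0 ≤ C2 := by positivity
  -- The powers of `t` are `(θ - 1) - θ/2 = θ/2 - 1` and `(θ - 1) + (r - 1)θ = rθ - 1`, both above
  -- `-1`.
  refine ⟨C1 ^ (1 - θ) * C2 ^ θ, θ / 2, r * θ, by positivity, by positivity, by positivity,
    fun N hN t ht => ?_⟩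
  have hN0 : (0 : ℝ) < N := by exact_mod_cast hN
  have hx : ‖newtonDefect α N t‖ ≤ C1 * (N : ℝ) ^ (-(r / 2)) * Real.exp t * t ^ (-1 : ℝ) := by
    obtain ⟨M, rfl⟩ := Nat.exists_eq_add_of_le' hN
    refine (norm_newtonDefect_le_div hα M ht).trans ?_
    gcongr
    obtain ⟨h1, h2⟩ := hC (M + 1) hN
    have := mul_le_mul_of_nonneg_left h2 (norm_nonneg α)
    simp only [C1]
    linarith
  have hy : ‖newtonDefect α N t‖ ≤ C2 * (N : ℝ) ^ (1 / 2 : ℝ) * Real.exp t *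
      (t ^ (-(1 / 2) : ℝ) + t ^ (r - 1)) := norm_newtonDefect_le_sqrt hα hN ht
  clear_value C1 C2
  have hD := norm_nonneg (newtonDefect α N t)
  calc ‖newtonDefect α N t‖
      = ‖newtonDefect α N t‖ ^ (1 - θ) * ‖newtonDefect α N t‖ ^ θ := by
        rw [← Real.rpow_add_of_nonneg hD (by linarith) hθ0.le]
        simp
    _ ≤ (C1 * (N : ℝ) ^ (-(r / 2)) * Real.exp t * t ^ (-1 : ℝ)) ^ (1 - θ) *
        (C2 * (N : ℝ) ^ (1 / 2 : ℝ) * Real.exp t * (t ^ (-(1 / 2) : ℝ) + t ^ (r - 1))) ^ θ :=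
        mul_le_mul (Real.rpow_le_rpow hD hx (by linarith)) (Real.rpow_le_rpow hD hy hθ0.le)
          (by positivity) (by positivity)
    _ = C1 ^ (1 - θ) * C2 ^ θ * (N : ℝ) ^ (-(r / 4)) * (Real.exp t * (t ^ (θ - 1) *
          (t ^ (-(1 / 2) : ℝ) + t ^ (r - 1)) ^ θ)) := by
        rw [Real.mul_rpow (by positivity) (by positivity),
          Real.mul_rpow (by positivity) (by positivity), Real.mul_rpow hC1 (by positivity),
          Real.mul_rpow (by positivity) (by positivity),
          Real.mul_rpow (by positivity) (by positivity), Real.mul_rpow hC2 (by positivity),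
          ← Real.rpow_mul hN0.le, ← Real.rpow_mul hN0.le, ← Real.rpow_mul ht.le]
        have e1 : (N : ℝ) ^ (-(r / 4)) =
            (N : ℝ) ^ (-(r / 2) * (1 - θ)) * (N : ℝ) ^ (1 / 2 * θ) := by
          rw [← Real.rpow_add hN0]
          congr 1
          linear_combination (-1 / 2) * hθ
        have e2 : Real.exp t = Real.exp t ^ (1 - θ) * Real.exp t ^ θ := by
          rw [← Real.rpow_add (Real.exp_pos t)]
          simp
        have e3 : -1 * (1 - θ) = θ - 1 := by ring
        rw [e3, e1]
        nth_rewrite 3 [e2]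
        ring
    _ ≤ _ := by
        refine mul_le_mul_of_nonneg_left (mul_le_mul_of_nonneg_left ?_ (Real.exp_pos t).le)
          (by positivity)
        calc t ^ (θ - 1) * (t ^ (-(1 / 2) : ℝ) + t ^ (r - 1)) ^ θ
            ≤ t ^ (θ - 1) * ((t ^ (-(1 / 2) : ℝ)) ^ θ + (t ^ (r - 1)) ^ θ) := by
              gcongr
              exact rpow_add_le_add_rpow_real (by positivity) (by positivity) hθ0.le hθ1.le
          _ = _ := by
              rw [← Real.rpow_mul ht.le, ← Real.rpow_mul ht.le, mul_add, ← Real.rpow_add ht,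
                ← Real.rpow_add ht]
              ring_nf

/-- The kernel of the difference between the `N`-th Newton sum and the Riemann-Liouville
integral. -/
def newtonKernel (ρ : ℝ) (α : ℂ) (N : ℕ) : ℝ → ℂ :=
  (Ioi 0).indicator fun t => (ρ : ℂ) ^ (α - 1) * newtonDefect α N (t / ρ)

theorem measurable_newtonDefect (α : ℂ) (N : ℕ) : Measurable (newtonDefect α N) := by
  refine Measurable.sub ?_ (measurable_rlKernel α)
  unfold newtonLaguerreDeriv
  fun_prop

theorem tendsto_expNorm_newtonKernel {α : ℂ} (hα : 0 < α.re) {ρ η : ℝ} (hρ : 0 < ρ)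
    (hη : 1 / ρ < η) :
    (∀ N, 1 ≤ N → ExpIntegrable η (newtonKernel ρ α N)) ∧
      Tendsto (fun N => expNorm η (newtonKernel ρ α N)) atTop (𝓝 0) := by
  obtain ⟨C, p, q, hC, hp, hq, hb⟩ := exists_norm_newtonDefect_le hα
  set g : ℝ → ℝ := fun t => Real.exp (-(η * t)) *
    (Real.exp (t / ρ) * ((t / ρ) ^ (p - 1) + (t / ρ) ^ (q - 1))) with hgdef
  have hpow : ∀ s : ℝ, 0 < s → IntegrableOn
      (fun t => Real.exp (-(η * t)) * (Real.exp (t / ρ) * (t / ρ) ^ (s - 1))) (Ioi 0) := by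
    intro s hs
    -- The factor `e^(t/ρ)` uses up `1/ρ` of the weight; the remaining decay rate `η - 1/ρ` is
    -- positive.
    have h := (integrableOn_rpow_mul_exp_neg_mul_rpow (p := 1) (s := s - 1) (b := η - 1 / ρ)
      (by linarith) one_pos (by linarith)).const_mul ((ρ ^ (s - 1))⁻¹)
    refine IntegrableOn.congr_fun h (fun t ht => ?_) measurableSet_Ioi
    rw [Real.div_rpow (le_of_lt ht) hρ.le, Real.rpow_one, ← mul_assoc (Real.exp _),
      ← Real.exp_add, show -(η - 1 / ρ) * t = -(η * t) + t / ρ by ring]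
    ring
  have hg : IntegrableOn g (Ioi 0) := by
    refine ((hpow p hp).add (hpow q hq)).congr (Eventually.of_forall fun t => ?_)
    simp only [hgdef, Pi.add_apply]
    ring
  set c := ‖(ρ : ℂ) ^ (α - 1)‖ * C
  have hle : ∀ N : ℕ, 1 ≤ N → ∀ t, ‖expWeight η (newtonKernel ρ α N) t‖ ≤
      c * (N : ℝ) ^ (-(α.re / 4)) * (Ioi 0).indicator g t := by
    intro N hN t
    rw [norm_expWeight, newtonKernel]
    by_cases ht : t ∈ Ioi (0 : ℝ)
    · rw [indicator_of_mem ht, indicator_of_mem ht, norm_mul]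
      calc _ ≤ Real.exp (-(η * t)) * (‖(ρ : ℂ) ^ (α - 1)‖ * (C * (N : ℝ) ^ (-(α.re / 4)) *
            (Real.exp (t / ρ) * ((t / ρ) ^ (p - 1) + (t / ρ) ^ (q - 1))))) := by
            gcongr
            exact hb N hN _ (div_pos ht hρ)
        _ = _ := by simp only [c, hgdef]; ring
    · simp [ht]
  have hgi := hg.integrable_indicator measurableSet_Ioi
  have hint : ∀ N, 1 ≤ N → ExpIntegrable η (newtonKernel ρ α N) := by
    intro N hN
    refine Integrable.mono' (hgi.const_mul (c * (N : ℝ) ^ (-(α.re / 4)))) ?_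
      (Eventually.of_forall (hle N hN))
    refine (by fun_prop : Continuous fun x : ℝ =>
      Real.exp (-(η * x))).aestronglyMeasurable.smul ?_
    refine Measurable.aestronglyMeasurable (Measurable.indicator ?_ measurableSet_Ioi)
    exact ((measurable_newtonDefect α N).comp (measurable_id.div_const ρ)).const_mul _
  refine ⟨hint, ?_⟩
  have h0 : Tendsto (fun N : ℕ => c * (N : ℝ) ^ (-(α.re / 4)) *
      ∫ t, (Ioi 0).indicator g t) atTop (𝓝 (c * 0 * ∫ t, (Ioi 0).indicator g t)) :=
    (((tendsto_rpow_neg_atTop (by positivity)).comp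
      tendsto_natCast_atTop_atTop).const_mul c).mul_const _
  rw [mul_zero, zero_mul] at h0
  refine squeeze_zero' (Eventually.of_forall fun N => expNorm_nonneg _ _) ?_ h0
  filter_upwards [eventually_ge_atTop 1] with N hN
  rw [← integral_norm_expWeight, ← integral_const_mul]
  exact integral_mono (Integrable.norm (hint N hN)) (hgi.const_mul _) (hle N hN)


/-! ### The Newton series of the integration operator, on functions -/

theorem eval_derivative_laguerre (n : ℕ) (t : ℝ) :
    (Polynomial.derivative (laguerre n)).eval t =
      ∑ k ∈ Finset.range n, (-1) ^ (k + 1) * (n.choose (k + 1) : ℝ) / k.factorial * t ^ k := by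
  rw [Polynomial.eval_eq_sum_range' (n := n + 1), Finset.sum_range_succ]
  · rw [Polynomial.coeff_derivative, coeff_laguerre, Nat.choose_succ_self]
    simp only [Nat.cast_zero, mul_zero, zero_div, zero_mul, add_zero]
    refine Finset.sum_congr rfl fun k _ => ?_
    rw [Polynomial.coeff_derivative, coeff_laguerre, Nat.factorial_succ]
    push_cast
    field_simp
  · refine Nat.lt_succ_of_le (Polynomial.natDegree_le_iff_coeff_eq_zero.2 fun k hk => ?_)
    rw [Polynomial.coeff_derivative, coeff_laguerre, Nat.choose_eq_zero_of_lt (by omega)]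
    simp

theorem rlKernel_natCast (k : ℕ) (t : ℝ) :
    rlKernel (k + 1 : ℕ) t = (k.factorial : ℂ)⁻¹ * (t : ℂ) ^ k := by
  rw [rlKernel]
  push_cast
  rw [Complex.Gamma_nat_eq_factorial, add_sub_cancel_right, Complex.cpow_natCast]

/-- The coefficient of `t^k` in `L_n'` is `P_(k+1)(n) / k!`, and `t^k / k!` is the kernel of
`J^(k+1)`; the power of `ρ` makes the Riemann-Liouville kernel invariant under the scaling. -/
theorem newtonKernel_eq {ρ : ℝ} (hρ : 0 < ρ) (α : ℂ) (N : ℕ) :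
    newtonKernel ρ α N = (∑ n ∈ Finset.range N, ∑ k ∈ Finset.range n,
      (pochhammerNewton n α * (pochhammerNewton (k + 1) n * (ρ : ℂ) ^ (α - (k + 1 : ℕ)))) •
        causalKernel (k + 1 : ℕ)) + (-1 : ℂ) • causalKernel α := by
  have hρ' : (ρ : ℂ) ≠ 0 := by exact_mod_cast hρ.ne'
  funext t
  by_cases ht : t ∈ Ioi (0 : ℝ)
  · have hk : ∀ β : ℂ, causalKernel β t = rlKernel β t := fun β => indicator_of_mem ht _
    have h1 : (ρ : ℂ) ^ (α - 1) * rlKernel α (t / ρ) = rlKernel α t := by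
      rw [rlKernel, rlKernel, Complex.ofReal_div,
        Complex.div_cpow_ofReal_nonneg (le_of_lt ht) hρ.le]
      have : (ρ : ℂ) ^ (α - 1) ≠ 0 := by
        rw [Ne, Complex.cpow_eq_zero_iff]
        simp [hρ']
      field_simp
    rw [newtonKernel, indicator_of_mem ht, newtonDefect, mul_sub, h1, newtonLaguerreDeriv,
      Finset.mul_sum]
    simp only [Pi.add_apply, Finset.sum_apply, Pi.smul_apply, hk, smul_eq_mul]
    rw [neg_one_mul, ← sub_eq_add_neg]
    congr 1
    refine Finset.sum_congr rfl fun n _ => ?_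
    rw [eval_derivative_laguerre, Complex.ofReal_sum, Finset.mul_sum, Finset.mul_sum]
    refine Finset.sum_congr rfl fun k _ => ?_
    rw [rlKernel_natCast k, pochhammerNewton_natCast]
    have h2 : (ρ : ℂ) ^ (α - (k + 1 : ℕ)) = (ρ : ℂ) ^ (α - 1) * ((ρ : ℂ) ^ k)⁻¹ := by
      rw [← Complex.cpow_natCast, ← Complex.cpow_neg, ← Complex.cpow_add _ _ hρ']
      congr 1
      push_cast
      ring
    rw [h2]
    push_cast
    rw [div_pow]
    field_simp
  · simp [newtonKernel, causalKernel, ht]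

theorem newtonSumFun_eq (a : EReal) (ρ : ℝ) (α : ℂ) (f : ℝ → ℂ) (N : ℕ) (x : ℝ) :
    newtonSumFun a ρ α f N x = (ρ : ℂ) ^ α * (∑ n ∈ Finset.range N, pochhammerNewton n α) * f x +
      ∑ n ∈ Finset.range N, ∑ k ∈ Finset.range n,
        (pochhammerNewton n α * (pochhammerNewton (k + 1) n * (ρ : ℂ) ^ (α - (k + 1 : ℕ)))) *
          (integ a)^[k + 1] f x := by
  rw [newtonSumFun, Finset.mul_sum, Finset.sum_mul, ← Finset.sum_add_distrib]
  refine Finset.sum_congr rfl fun n _ => ?_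
  rw [Finset.sum_range_succ', mul_add, Finset.mul_sum, add_comm]
  congr 1
  · simp only [pochhammerNewton_zero, Nat.cast_zero, sub_zero, Function.iterate_zero, id]
    ring
  · exact Finset.sum_congr rfl fun k _ => by ring

theorem ae_newtonSumFun_sub {a : EReal} {c η ρ : ℝ} (hη : 0 < η) (hρ : 0 < ρ) {α : ℂ}
    (hα : 0 < α.re) {f : ℝ → ℂ} (hf : ExpIntegrable η ((interval a c).indicator f)) (N : ℕ) :
    ∀ᵐ x, x ∈ interval a c → newtonSumFun a ρ α f N x - riemannLiouville a α f x =
      (ρ : ℂ) ^ α * (∑ n ∈ Finset.range N, pochhammerNewton n α) * f x +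
        cconv ((interval a c).indicator f) (newtonKernel ρ α N) x := by
  filter_upwards [ae_all_iff.2 (ae_iterate_integ hη hf),
    hf.ae_cconvExistsAt (expIntegrable_causalKernel hη hα), ae_all_iff.2 fun k : ℕ =>
    hf.ae_cconvExistsAt (expIntegrable_causalKernel hη (natCast_succ_re_pos k))] with x h1 h2 h3 hx
  have h4 : ∀ n : ℕ, _ := fun n => CConvExistsAt.sum (f := (interval a c).indicator f)
    (k := fun k : ℕ => (pochhammerNewton n α * (pochhammerNewton (k + 1) n *
      (ρ : ℂ) ^ (α - (k + 1 : ℕ)))) • causalKernel (k + 1 : ℕ)) (x := x) (Finset.range n)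
    fun k _ => (h3 k).const_smul _
  obtain ⟨h5, h6⟩ := CConvExistsAt.sum (Finset.range N) fun n _ => (h4 n).1
  rw [newtonKernel_eq hρ, cconv_add_right h5 (h2.const_smul _), h6, cconv_smul_right,
    newtonSumFun_eq, riemannLiouville_eq_cconv a (interval_subset_Iio a c hx).le, neg_one_mul,
    add_sub_assoc, sub_eq_add_neg]
  congr 2
  refine Finset.sum_congr rfl fun n _ => ?_
  rw [(h4 n).2]
  refine Finset.sum_congr rfl fun k _ => ?_
  rw [cconv_smul_right, h1 k hx, riemannLiouville_eq_cconv a (interval_subset_Iio a c hx).le]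

/-- The quantitative form of the Newton series: the identity part is estimated in `L¹(a, c)`
directly, the convolution part by Young's inequality in the weighted space. -/
theorem integrableOn_newtonSumFun_sub {a : EReal} {c η ρ : ℝ} (hη : 1 / ρ < η) (hρ : 0 < ρ)
    {α : ℂ} (hα : 0 < α.re) {f : ℝ → ℂ} (hfi : IntegrableOn f (interval a c))
    (hf : ExpIntegrable η ((interval a c).indicator f)) {N : ℕ} (hN : 1 ≤ N) :
    IntegrableOn (fun x => newtonSumFun a ρ α f N x - riemannLiouville a α f x) (interval a c) ∧
      ∫ x in interval a c, ‖newtonSumFun a ρ α f N x - riemannLiouville a α f x‖ ≤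
        ‖(ρ : ℂ) ^ α‖ * ‖∑ n ∈ Finset.range N, pochhammerNewton n α‖ *
          (∫ x in interval a c, ‖f x‖) + Real.exp (η * c) *
          (expNorm η ((interval a c).indicator f) * expNorm η (newtonKernel ρ α N)) := by
  have hη0 : 0 < η := (by positivity : 0 < 1 / ρ).trans hη
  have hm := measurableSet_interval a c
  have hK := (tendsto_expNorm_newtonKernel hα hρ hη).1 N hN
  have hae := (ae_restrict_iff' hm).2 (ae_newtonSumFun_sub hη0 hρ hα hf N)
  obtain ⟨hc1, hc2⟩ := (hf.convolution hK).integrableOn_Iio hη0 c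
  have hc3 := hc1.mono_set (interval_subset_Iio a c)
  have h1 : IntegrableOn (fun x => (ρ : ℂ) ^ α * (∑ n ∈ Finset.range N, pochhammerNewton n α) *
      f x) (interval a c) := hfi.const_mul _
  refine ⟨(h1.add hc3).congr (hae.mono fun x hx => hx.symm), ?_⟩
  calc ∫ x in interval a c, ‖newtonSumFun a ρ α f N x - riemannLiouville a α f x‖
      = ∫ x in interval a c, ‖(ρ : ℂ) ^ α * (∑ n ∈ Finset.range N, pochhammerNewton n α) * f x +
          cconv ((interval a c).indicator f) (newtonKernel ρ α N) x‖ :=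
        integral_congr_ae (hae.mono fun x hx => by simp only [hx])
    _ ≤ ∫ x in interval a c, (‖(ρ : ℂ) ^ α‖ * ‖∑ n ∈ Finset.range N, pochhammerNewton n α‖ *
          ‖f x‖ + ‖cconv ((interval a c).indicator f) (newtonKernel ρ α N) x‖) := by
        refine integral_mono (h1.add hc3).norm ((hfi.norm.const_mul _).add hc3.norm) fun x => ?_
        refine (norm_add_le _ _).trans_eq ?_
        rw [norm_mul, norm_mul]
    _ ≤ _ := by
        rw [integral_add (hfi.norm.const_mul _) hc3.norm, integral_const_mul]
        gcongr
        calc _ ≤ ∫ x in Iio c, ‖cconv ((interval a c).indicator f) (newtonKernel ρ α N) x‖ :=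
              setIntegral_mono_set hc1.norm (Eventually.of_forall fun _ => norm_nonneg _)
                (interval_subset_Iio a c).eventuallyLE
          _ ≤ _ := hc2.trans (mul_le_mul_of_nonneg_left (expNorm_cconv_le hf hK)
                (Real.exp_pos _).le)

/-! ### Weighted integrability of the given functions -/

theorem expIntegrable_indicator_of_coe {a c η : ℝ} {f : ℝ → ℂ} (hη : 0 < η)
    (hf : IntegrableOn f (Ioo a c)) : ExpIntegrable η ((Ioo a c).indicator f) ∧
      expNorm η ((Ioo a c).indicator f) ≤ Real.exp (-(η * a)) * ∫ x in Ioo a c, ‖f x‖ := by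
  have hi := hf.integrable_indicator measurableSet_Ioo
  have hb : ∀ x, ‖expWeight η ((Ioo a c).indicator f) x‖ ≤
      Real.exp (-(η * a)) * ‖(Ioo a c).indicator f x‖ := by
    intro x
    rw [norm_expWeight]
    by_cases hx : x ∈ Ioo a c
    · refine mul_le_mul_of_nonneg_right (Real.exp_le_exp.2 ?_) (norm_nonneg _)
      have := mul_le_mul_of_nonneg_left hx.1.le hη.le
      linarith
    · simp [hx]
  have h1 : ExpIntegrable η ((Ioo a c).indicator f) := by
    refine Integrable.mono' (hi.norm.const_mul _) ?_ (Eventually.of_forall hb)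
    exact (by fun_prop : Continuous fun x : ℝ => Real.exp (-(η * x))).aestronglyMeasurable.smul
      hi.aestronglyMeasurable
  refine ⟨h1, ?_⟩
  rw [← integral_norm_expWeight]
  refine (integral_mono (Integrable.norm h1) (hi.norm.const_mul _) hb).trans_eq ?_
  rw [integral_const_mul]
  simp only [norm_indicator_eq_indicator_norm]
  rw [integral_indicator measurableSet_Ioo]

/-- Near `-∞` the weighted function is dominated by `e^((ε-η)x)`; to the right of any fixed point
the weight is bounded and `f` is integrable. -/
theorem expIntegrable_indicator_of_isBigO {c η ε : ℝ} {f : ℝ → ℂ} (hη : 0 < η) (hε : η < ε)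
    (hf : IntegrableOn f (interval ⊥ c))
    (hO : f =O[atBot ⊓ ae volume] fun x => Real.exp (ε * x)) :
    ExpIntegrable η ((interval ⊥ c).indicator f) := by
  have hi := hf.integrable_indicator (measurableSet_interval ⊥ c)
  obtain ⟨C, hC0, hC⟩ := hO.exists_pos
  obtain ⟨p, hp, q, hq, hpq⟩ := Filter.eventually_inf.1 hC.bound
  obtain ⟨x₀, hx₀⟩ := eventually_atBot.1 hp
  have hg := IntegrableOn.integrable_indicator ((integrableOn_exp_mul_Iic (a := ε - η)
    (by linarith) x₀).const_mul C) measurableSet_Iic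
  refine Integrable.mono' (hg.add (hi.norm.const_mul (Real.exp (-(η * x₀))))) ?_ ?_
  · exact (by fun_prop : Continuous fun x : ℝ => Real.exp (-(η * x))).aestronglyMeasurable.smul
      hi.aestronglyMeasurable
  · filter_upwards [hq] with x hx
    rw [norm_expWeight, Pi.add_apply]
    by_cases hxx : x ≤ x₀
    · rw [indicator_of_mem (mem_Iic.2 hxx)]
      have h1 : ‖(interval ⊥ c).indicator f x‖ ≤ C * Real.exp (ε * x) := by
        refine (norm_indicator_le_norm_self f x).trans ((hpq x ⟨hx₀ x hxx, hx⟩).trans_eq ?_)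
        rw [Real.norm_eq_abs, Real.abs_exp]
      have h2 : Real.exp ((ε - η) * x) = Real.exp (-(η * x)) * Real.exp (ε * x) := by
        rw [← Real.exp_add]
        ring_nf
      have h3 := mul_le_mul_of_nonneg_left h1 (Real.exp_pos (-(η * x))).le
      have h4 : 0 ≤ Real.exp (-(η * x₀)) * ‖(interval ⊥ c).indicator f x‖ := by positivity
      rw [h2]
      linarith
    · rw [indicator_of_notMem (s := Iic x₀) (by simpa using hxx), zero_add]
      refine mul_le_mul_of_nonneg_right (Real.exp_le_exp.2 ?_) (norm_nonneg _)
      have := mul_le_mul_of_nonneg_left (not_le.1 hxx).le hη.le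
      linarith

theorem exists_expIntegrable {a b : EReal} {f : ℝ → ℂ} {ρ : ℝ} (hab : a < b) (hρ : 0 < ρ)
    (hf : IntegrableOn f (interval a b))
    (hO : a = ⊥ → ∃ ε : ℝ, 1 / ρ < ε ∧
      f =O[atBot ⊓ ae volume] fun x => Real.exp (ε * x)) {c : ℝ} (hc : (c : EReal) ≤ b) :
    ∃ η : ℝ, 1 / ρ < η ∧ ExpIntegrable η ((interval a c).indicator f) := by
  have hρ' : 0 < 1 / ρ := by positivity
  have hf' := hf.mono_set (interval_mono (a := a) hc)
  induction a with
  | bot =>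
    obtain ⟨ε, hε, h⟩ := hO rfl
    -- The weight must exceed `1/ρ` for the kernels and stay below `ε` for `f`; the midpoint does
    -- both.
    exact ⟨(1 / ρ + ε) / 2, by linarith,
      expIntegrable_indicator_of_isBigO (by linarith) (by linarith) hf' h⟩
  | top => exact absurd hab not_top_lt
  | coe a =>
    rw [interval_coe] at hf' ⊢
    exact ⟨1 / ρ + 1, by linarith, (expIntegrable_indicator_of_coe (by linarith) hf').1⟩

theorem newton_series_function {α : ℂ} (hα : 0 < α.re) (a b : EReal) (f : ℝ → ℂ) (ρ : ℝ)
    (hab : a < b) (hρ : 0 < ρ) (hf : IntegrableOn f (interval a b))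
    (hO : a = ⊥ → ∃ ε : ℝ, 1 / ρ < ε ∧
      f =O[atBot ⊓ ae volume] fun x => Real.exp (ε * x)) (c : ℝ) (hc : (c : EReal) ≤ b) :
    (∀ k : ℕ, IntegrableOn ((integ a)^[k] f) (interval a c)) ∧
    (∀ᵐ x ∂(volume.restrict (interval a c)),
      IntegrableOn (fun y => f y * ((x - y : ℝ) : ℂ) ^ (α - 1)) (interval a x)) ∧
    IntegrableOn (riemannLiouville a α f) (interval a c) ∧
    Tendsto (fun N => eLpNorm
        (fun x => newtonSumFun a ρ α f N x - riemannLiouville a α f x) 1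
        (volume.restrict (interval a c))) atTop (𝓝 0) := by
  obtain ⟨η, hη, hF⟩ := exists_expIntegrable hab hρ hf hO hc
  have hη0 : 0 < η := (by positivity : 0 < 1 / ρ).trans hη
  have hm := measurableSet_interval a c
  have hf' := hf.mono_set (interval_mono (a := a) hc)
  have hRL : ∀ β : ℂ, 0 < β.re →
      IntegrableOn (cconv ((interval a c).indicator f) (causalKernel β)) (interval a c) :=
    fun β hβ => ((hF.convolution (expIntegrable_causalKernel hη0 hβ)).integrableOn_Iio
      hη0 c).1.mono_set (interval_subset_Iio a c)
  refine ⟨fun k => ?_, ?_, ?_, ?_⟩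
  · rcases k with _ | k
    · exact hf'
    · refine (hRL (k + 1 : ℕ) (natCast_succ_re_pos k)).congr ((ae_restrict_iff' hm).2 ?_)
      filter_upwards [ae_iterate_integ hη0 hF k] with x hx hxc
      rw [hx hxc, riemannLiouville_eq_cconv a (interval_subset_Iio a c hxc).le]
  · refine (ae_restrict_iff' hm).2 ?_
    filter_upwards [hF.ae_cconvExistsAt (expIntegrable_causalKernel hη0 hα)] with x hx hxc
    exact CConvExistsAt.integrableOn (interval_subset_Iio a c hxc).le hα hx
  · exact (hRL α hα).congr_fun (fun x hx =>
      (riemannLiouville_eq_cconv a (interval_subset_Iio a c hx).le α f).symm) hm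
  · have h0 := ((tendsto_sum_pochhammerNewton hα).const_mul ‖(ρ : ℂ) ^ α‖).mul_const
      (∫ x in interval a c, ‖f x‖)
    have h1 := (((tendsto_expNorm_newtonKernel hα hρ hη).2.const_mul
      (expNorm η ((interval a c).indicator f))).const_mul (Real.exp (η * c)))
    have h2 := ENNReal.tendsto_ofReal (h0.add h1)
    simp only [mul_zero, zero_mul, add_zero, ENNReal.ofReal_zero] at h2
    refine tendsto_of_tendsto_of_tendsto_of_le_of_le' tendsto_const_nhds h2
      (Eventually.of_forall fun _ => zero_le) ?_
    filter_upwards [eventually_ge_atTop 1] with N hN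
    obtain ⟨h3, h4⟩ := integrableOn_newtonSumFun_sub hη hρ hα hf' hF hN
    rw [eLpNorm_one_eq_lintegral_enorm, ← ofReal_integral_norm_eq_lintegral_enorm h3]
    exact ENNReal.ofReal_le_ofReal h4

/-! ### The Newton series of the integration operator, on `L¹(a, b)` -/

theorem integ_congr {a b : ℝ} {f g : ℝ → ℂ} (h : f =ᵐ[volume.restrict (Ioo a b)] g) {x : ℝ}
    (hx : x ∈ Ioo a b) : integ a f x = integ a g x := by
  have := volterra_congr (k := fun _ => 1) h hx
  simpa [volterra, integ, interval_coe] using this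

theorem coeFn_integOp_pow {a b : ℝ} (f : L1 a b) (k : ℕ) :
    (integOp a b ^ k) f =ᵐ[volume.restrict (Ioo a b)] (integ a)^[k] f := by
  induction k with
  | zero => rfl
  | succ k ih =>
    rw [pow_succ', mul_apply_eq_comp, Function.iterate_succ_apply']
    filter_upwards [coeFn_integOp ((integOp a b ^ k) f), ae_restrict_mem measurableSet_Ioo]
      with x hx hxm
    rw [hx, integ_congr ih hxm]

theorem coeFn_sum_smul {a b : ℝ} {ι : Type*} (s : Finset ι) (c : ι → ℂ) (u : ι → L1 a b)
    (v : ι → ℝ → ℂ) (h : ∀ i ∈ s, u i =ᵐ[volume.restrict (Ioo a b)] v i) :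
    (∑ i ∈ s, c i • u i : L1 a b) =ᵐ[volume.restrict (Ioo a b)]
      fun x => ∑ i ∈ s, c i * v i x := by
  refine (Lp.coeFn_finsetSum s fun i => c i • u i).trans ?_
  have h1 : ∀ i ∈ s, ∀ᵐ x ∂(volume.restrict (Ioo a b)), (c i • u i : L1 a b) x = c i * v i x := by
    intro i hi
    filter_upwards [Lp.coeFn_smul (c i) (u i), h i hi] with x h1 h2
    rw [h1, Pi.smul_apply, h2, smul_eq_mul]
  filter_upwards [(Finset.eventually_all s).2 h1] with x hx
  rw [Finset.sum_apply]
  exact Finset.sum_congr rfl hx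

theorem coeFn_newtonSum {a b : ℝ} (ρ : ℝ) (α : ℂ) (N : ℕ) (f : L1 a b) :
    newtonSum ρ α (integOp a b) N f =ᵐ[volume.restrict (Ioo a b)] newtonSumFun a ρ α f N := by
  have h : newtonSum ρ α (integOp a b) N f = ∑ n ∈ Finset.range N, pochhammerNewton n α •
      ∑ k ∈ Finset.range (n + 1), (pochhammerNewton k n * (ρ : ℂ) ^ (α - k)) •
        (integOp a b ^ k) f := by
    simp only [newtonSum, sum_apply, smul_apply]
  rw [h]
  exact coeFn_sum_smul _ _ _ _ fun n _ => coeFn_sum_smul _ _ _ _ fun k _ => coeFn_integOp_pow f k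

theorem integral_norm_newtonSumFun_sub_le {a b η ρ : ℝ} (hη : 1 / ρ < η) (hρ : 0 < ρ)
    {α : ℂ} (hα : 0 < α.re) {f : ℝ → ℂ} (hf : IntegrableOn f (Ioo a b)) {N : ℕ} (hN : 1 ≤ N) :
    ∫ x in Ioo a b, ‖newtonSumFun a ρ α f N x - riemannLiouville a α f x‖ ≤
      (‖(ρ : ℂ) ^ α‖ * ‖∑ n ∈ Finset.range N, pochhammerNewton n α‖ +
        Real.exp (η * b) * (Real.exp (-(η * a)) * expNorm η (newtonKernel ρ α N))) *
          ∫ x in Ioo a b, ‖f x‖ := by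
  have hη0 : 0 < η := (by positivity : 0 < 1 / ρ).trans hη
  obtain ⟨hF1, hF2⟩ := expIntegrable_indicator_of_coe hη0 hf
  rw [← interval_coe] at hf hF1 hF2 ⊢
  refine (integrableOn_newtonSumFun_sub hη hρ hα hf hF1 hN).2.trans ?_
  rw [add_mul, mul_assoc (Real.exp _)]
  refine add_le_add le_rfl (mul_le_mul_of_nonneg_left ?_ (Real.exp_pos _).le)
  refine (mul_le_mul_of_nonneg_right hF2 (expNorm_nonneg _ _)).trans_eq ?_
  ring

theorem newton_series_operator {α : ℂ} (hα : 0 < α.re) (a b : ℝ) {ρ : ℝ} (hρ : 0 < ρ) :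
    Tendsto (newtonSum ρ α (integOp a b)) atTop (𝓝 (riemannLiouvilleOp a b α hα)) := by
  -- On a bounded interval any weight above `1/ρ` will do, since it is comparable to `1` there.
  have hη : 1 / ρ < 1 / ρ + 1 := by linarith
  set η := 1 / ρ + 1
  have h0 := (tendsto_sum_pochhammerNewton hα).const_mul ‖(ρ : ℂ) ^ α‖
  have h1 := ((tendsto_expNorm_newtonKernel hα hρ hη).2.const_mul
    (Real.exp (-(η * a)))).const_mul (Real.exp (η * b))
  have h2 := h0.add h1
  simp only [mul_zero, add_zero] at h2
  rw [tendsto_iff_norm_sub_tendsto_zero]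
  refine squeeze_zero' (Eventually.of_forall fun _ => norm_nonneg _) ?_ h2
  filter_upwards [eventually_ge_atTop 1] with N hN
  have hK0 := expNorm_nonneg η (newtonKernel ρ α N)
  refine ContinuousLinearMap.opNorm_le_bound _ (by positivity) fun f => ?_
  rw [L1.norm_eq_integral_norm, L1.norm_eq_integral_norm]
  refine le_trans (le_of_eq (integral_congr_ae ?_))
    (integral_norm_newtonSumFun_sub_le hη hρ hα (integrableOn_coe f) hN)
  rw [sub_apply]
  filter_upwards [Lp.coeFn_sub (newtonSum ρ α (integOp a b) N f)
    (riemannLiouvilleOp a b α hα f), coeFn_newtonSum ρ α N f,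
    coeFn_riemannLiouvilleOp hα f] with x e1 e2 e3
  rw [e1, Pi.sub_apply, e2, e3]


/-! ### Fractional powers of shifts of an element with entire resolvent series -/

section Series

variable {A : Type*} [NormedRing A] [NormedAlgebra ℂ A]

/-- The series `∑_k T^k w^(-k-1)` converges for all `w ≠ 0`. -/
def HasEntireResolvent (T : A) : Prop := ∀ s : ℝ, 0 ≤ s → Summable fun k : ℕ => s ^ k * ‖T ^ k‖

theorem HasEntireResolvent.hasSum_resolvent [CompleteSpace A] {T : A}
    (hT : HasEntireResolvent T) {w : ℂ}
    (hw : w ≠ 0) : IsUnit (algebraMap ℂ A w - T) ∧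
      HasSum (fun k : ℕ => (w⁻¹) ^ (k + 1) • T ^ k) (resolvent T w) := by
  have hs : Summable fun k : ℕ => (w⁻¹ • T) ^ k := by
    refine Summable.of_norm ((hT ‖w⁻¹‖ (norm_nonneg _)).congr fun k => ?_)
    rw [smul_pow, norm_smul, norm_pow w⁻¹]
  have e : algebraMap ℂ A w - T = w • (1 - w⁻¹ • T) := by
    rw [smul_sub, smul_inv_smul₀ hw, Algebra.algebraMap_eq_smul_one]
  let u : Aˣ := ⟨algebraMap ℂ A w - T, w⁻¹ • ∑' k : ℕ, (w⁻¹ • T) ^ k,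
    by rw [e, smul_mul_smul_comm, mul_inv_cancel₀ hw, hs.one_sub_mul_tsum_pow, one_smul],
    by rw [e, smul_mul_smul_comm, inv_mul_cancel₀ hw, hs.tsum_pow_mul_one_sub, one_smul]⟩
  refine ⟨u.isUnit, ?_⟩
  have h : resolvent T w = w⁻¹ • ∑' k : ℕ, (w⁻¹ • T) ^ k := Ring.inverse_unit u
  rw [h]
  refine (hs.hasSum.const_smul w⁻¹).congr_fun fun k => ?_
  rw [smul_pow, smul_smul, pow_succ']

theorem resolvent_add_smul_one (T : A) (c z : ℂ) :
    resolvent (T + c • (1 : A)) z = resolvent T (z - c) := by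
  rw [resolvent, resolvent]
  congr 1
  rw [map_sub, Algebra.algebraMap_eq_smul_one c]
  abel

theorem HasEntireResolvent.spectrum_subset [CompleteSpace A] {T : A}
    (hT : HasEntireResolvent T) (c : ℂ) :
    spectrum ℂ (T + c • (1 : A)) ⊆ {c} := by
  intro z hz
  by_contra hne
  have hne' : z - c ≠ 0 := sub_ne_zero.2 hne
  refine hz ?_
  have h := (hT.hasSum_resolvent hne').1
  rw [spectrum.mem_resolventSet_iff]
  convert h using 1
  rw [map_sub, Algebra.algebraMap_eq_smul_one c]
  abel

theorem iteratedDeriv_cpow_const (α : ℂ) (n : ℕ) {z : ℂ} (hz : z ∈ Complex.slitPlane) :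
    iteratedDeriv n (fun z : ℂ => z ^ α) z =
      n.factorial * Ring.choose α n * z ^ (α - n) := by
  induction n generalizing z with
  | zero => simp
  | succ n ih =>
    rw [iteratedDeriv_succ]
    have h1 : iteratedDeriv n (fun z : ℂ => z ^ α) =ᶠ[𝓝 z]
        fun z => n.factorial * Ring.choose α n * z ^ (α - n) := by
      filter_upwards [Complex.isOpen_slitPlane.mem_nhds hz] with y hy using ih hy
    have h2 := ((hasDerivAt_id' z).cpow_const (c := α - n) hz).const_mul
      (n.factorial * Ring.choose α n)
    rw [h1.deriv_eq, h2.deriv, Nat.factorial_succ]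
    push_cast
    rw [show α - (n + 1 : ℂ) = α - n - 1 by ring]
    linear_combination -(n.factorial : ℂ) * z ^ (α - n - 1) * add_one_mul_choose_succ α n

theorem closedBall_subset_slitPlane {ε : ℝ} (hε : 0 < ε) :
    Metric.closedBall (ε : ℂ) (ε / 2) ⊆ Complex.slitPlane := by
  intro z hz
  rw [Metric.mem_closedBall, dist_eq_norm] at hz
  left
  have h := (Complex.abs_re_le_norm (z - ε)).trans hz
  rw [Complex.sub_re, Complex.ofReal_re, abs_le] at h
  linarith [h.1]

/-- Cauchy's formula for the `k`-th derivative of `z^α` at the centre `ε`. -/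
theorem circleIntegral_cpow (α : ℂ) {ε : ℝ} (hε : 0 < ε) (k : ℕ) :
    ∮ z in C(ε, ε / 2), ((z - ε)⁻¹) ^ (k + 1) * z ^ α =
      2 * Real.pi * Complex.I * (Ring.choose α k * (ε : ℂ) ^ (α - k)) := by
  have hd : DifferentiableOn ℂ (fun z : ℂ => z ^ α) (Metric.closedBall (ε : ℂ) (ε / 2)) :=
    fun z hz => ((hasDerivAt_id z).cpow_const
      (closedBall_subset_slitPlane hε hz)).differentiableAt.differentiableWithinAt
  have h := hd.circleIntegral_one_div_sub_center_pow_smul (by positivity) k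
  rw [iteratedDeriv_cpow_const α k
    (closedBall_subset_slitPlane hε (Metric.mem_closedBall_self (by positivity)))] at h
  simp only [smul_eq_mul, one_div, ← inv_pow] at h
  rw [h]
  have : (k.factorial : ℂ) ≠ 0 := by exact_mod_cast k.factorial_ne_zero
  field_simp

/-- The binomial series of `(T + ε)^α`. -/
def shiftPow (T : A) (α : ℂ) (ε : ℝ) : A :=
  ∑' k : ℕ, (Ring.choose α k * (ε : ℂ) ^ (α - k)) • T ^ k

/-- The Neumann series of the resolvent in powers of `(z - ε)⁻¹` converges uniformly on the circle
`|z - ε| = ε/2` and is integrated term by term. -/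
theorem HasEntireResolvent.circleIntegral_eq [CompleteSpace A] {T : A}
    (hT : HasEntireResolvent T) (α : ℂ) {ε : ℝ}
    (hε : 0 < ε) : (2 * Real.pi * Complex.I : ℂ)⁻¹ • ∮ z in C(ε, ε / 2),
      z ^ α • resolvent (T + (ε : ℂ) • (1 : A)) z = shiftPow T α ε := by
  have hε2 : 0 < ε / 2 := by positivity
  obtain ⟨B, hB⟩ := (isCompact_closedBall (ε : ℂ) (ε / 2)).exists_bound_of_continuousOn
    (f := fun z : ℂ => z ^ α) fun z hz => ((hasDerivAt_id z).cpow_const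
      (closedBall_subset_slitPlane hε hz)).continuousAt.continuousWithinAt
  have hc : ∀ θ : ℝ, circleMap (ε : ℂ) (ε / 2) θ - ε ≠ 0 := fun θ =>
    sub_ne_zero.2 (circleMap_ne_center hε2.ne')
  have hn : ∀ θ : ℝ, ‖circleMap (ε : ℂ) (ε / 2) θ - ε‖ = ε / 2 := fun θ => by
    rw [← dist_eq_norm, ← Metric.mem_sphere]
    exact circleMap_mem_sphere _ hε2.le θ
  have hball : ∀ θ : ℝ, circleMap (ε : ℂ) (ε / 2) θ ∈ Metric.closedBall (ε : ℂ) (ε / 2) :=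
    fun θ => circleMap_mem_closedBall _ hε2.le θ
  have hsum : Summable fun k : ℕ => ((ε / 2)⁻¹) ^ (k + 1) * ‖T ^ k‖ := by
    refine ((hT (ε / 2)⁻¹ (by positivity)).mul_left (ε / 2)⁻¹).congr fun k => ?_
    rw [pow_succ']
    ring
  have key : HasSum (fun k : ℕ => ∮ z in C(ε, ε / 2),
      (((z - ε)⁻¹) ^ (k + 1) * z ^ α) • T ^ k)
      (∮ z in C(ε, ε / 2), z ^ α • resolvent (T + (ε : ℂ) • (1 : A)) z) := by
    refine intervalIntegral.hasSum_integral_of_dominated_convergence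
      (fun k _ => ε / 2 * (B * (((ε / 2)⁻¹) ^ (k + 1) * ‖T ^ k‖))) (fun k => ?_) (fun k => ?_)
      ?_ ?_ ?_
    · refine Continuous.aestronglyMeasurable ?_
      have h1 : Continuous fun θ : ℝ => (circleMap (ε : ℂ) (ε / 2) θ - ε)⁻¹ :=
        ((continuous_circleMap _ _).sub continuous_const).inv₀ hc
      have h2 : Continuous fun θ : ℝ => (circleMap (ε : ℂ) (ε / 2) θ) ^ α :=
        (continuous_circleMap _ _).cpow continuous_const
          fun θ => closedBall_subset_slitPlane hε (hball θ)
      simp only [deriv_circleMap]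
      fun_prop
    · refine Eventually.of_forall fun θ _ => ?_
      rw [norm_smul, norm_smul, norm_mul, norm_pow, norm_inv, hn, deriv_circleMap]
      simp only [norm_mul, norm_circleMap_zero, Complex.norm_I, mul_one, abs_of_pos hε2]
      have h1 := hB _ (hball θ)
      have h2 : 0 ≤ ((ε / 2)⁻¹) ^ (k + 1) * ‖T ^ k‖ := by positivity
      have h3 := mul_le_mul_of_nonneg_right h1 h2
      refine mul_le_mul_of_nonneg_left (le_of_eq_of_le ?_ h3) hε2.le
      ring
    · exact Eventually.of_forall fun θ _ => (hsum.mul_left B).mul_left _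
    · exact intervalIntegrable_const
    · refine Eventually.of_forall fun θ _ => HasSum.const_smul _ ?_
      simp only [resolvent_add_smul_one]
      refine ((hT.hasSum_resolvent (hc θ)).2.const_smul _).congr_fun fun k => ?_
      rw [smul_smul, mul_comm]
  have hterm : ∀ k : ℕ, ∮ z in C(ε, ε / 2), (((z - ε)⁻¹) ^ (k + 1) * z ^ α) • T ^ k =
      (2 * Real.pi * Complex.I : ℂ) • (Ring.choose α k * (ε : ℂ) ^ (α - k)) • T ^ k := by
    intro k
    rw [circleIntegral.integral_smul_const, circleIntegral_cpow α hε, smul_smul]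
  simp only [hterm] at key
  have h2 := key.const_smul ((2 * Real.pi * Complex.I : ℂ)⁻¹)
  simp only [inv_smul_smul₀ Complex.two_pi_I_ne_zero] at h2
  rw [shiftPow, h2.tsum_eq]

theorem norm_choose_eq (α : ℂ) (k : ℕ) : ‖Ring.choose α k‖ = ‖pochhammerNewton k α‖ := by
  rw [pochhammerNewton_eq_choose, norm_mul, norm_pow, norm_neg, norm_one, one_pow, one_mul]

theorem norm_ofReal_cpow_sub_natCast (α : ℂ) {ε : ℝ} (hε : 0 < ε) (k : ℕ) :
    ‖(ε : ℂ) ^ (α - k)‖ = ε ^ α.re * (ε⁻¹) ^ k := by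
  rw [Complex.norm_cpow_eq_rpow_re_of_pos hε, Complex.sub_re, Complex.natCast_re,
    Real.rpow_sub hε, Real.rpow_natCast, inv_pow, div_eq_mul_inv]

theorem norm_choose_le {α : ℂ} (hα : 0 < α.re) (k : ℕ) :
    ‖Ring.choose α k‖ ≤ ∑' n, ‖pochhammerNewton n α‖ := by
  rw [norm_choose_eq]
  exact (summable_norm_pochhammerNewton hα).le_tsum k fun _ _ => norm_nonneg _

theorem HasEntireResolvent.summable_shiftPow {T : A} (hT : HasEntireResolvent T) {α : ℂ}
    (hα : 0 < α.re) {ε : ℝ} (hε : 0 < ε) :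
    Summable fun k : ℕ => ‖(Ring.choose α k * (ε : ℂ) ^ (α - k)) • T ^ k‖ := by
  refine Summable.of_nonneg_of_le (fun _ => norm_nonneg _) (fun k => ?_)
    ((hT ε⁻¹ (by positivity)).mul_left ((∑' n, ‖pochhammerNewton n α‖) * ε ^ α.re))
  rw [norm_smul, norm_mul, norm_ofReal_cpow_sub_natCast α hε, ← mul_assoc, ← mul_assoc]
  gcongr
  exact norm_choose_le hα k

/-- Cauchy product of the two binomial series and Vandermonde's identity. -/
theorem HasEntireResolvent.shiftPow_add [CompleteSpace A] {T : A}
    (hT : HasEntireResolvent T) {α β : ℂ}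
    (hα : 0 < α.re) (hβ : 0 < β.re) {ε : ℝ} (hε : 0 < ε) :
    shiftPow T (α + β) ε = shiftPow T α ε * shiftPow T β ε := by
  have hε' : (ε : ℂ) ≠ 0 := by exact_mod_cast hε.ne'
  rw [shiftPow, shiftPow, shiftPow, tsum_mul_tsum_eq_tsum_sum_antidiagonal_of_summable_norm
    (hT.summable_shiftPow hα hε) (hT.summable_shiftPow hβ hε)]
  congr 1
  funext k
  rw [Ring.add_choose_eq k (Commute.all α β), Finset.sum_mul, Finset.sum_smul]
  refine Finset.sum_congr rfl fun ij hij => ?_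
  rw [smul_mul_smul_comm, ← pow_add, Finset.HasAntidiagonal.mem_antidiagonal.1 hij]
  congr 1
  rw [mul_mul_mul_comm, ← Complex.cpow_add _ _ hε',
    ← Finset.HasAntidiagonal.mem_antidiagonal.1 hij]
  congr 2
  push_cast
  ring

end Series

/-! ### The Riemann-Liouville operators on `L¹(a, b)` -/

theorem ae_riemannLiouville_of_ae_eq_Ioo {a b : ℝ} {f g : ℝ → ℂ} (hf : IntegrableOn f (Ioo a b))
    {α β : ℂ} (hα : 0 < α.re) (hβ : 0 < β.re)
    (hg : g =ᵐ[volume.restrict (Ioo a b)] riemannLiouville a α f) :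
    riemannLiouville a β g =ᵐ[volume.restrict (Ioo a b)] riemannLiouville a (α + β) f := by
  have hF := (expIntegrable_indicator_of_coe one_pos hf).1
  have hg' := (ae_restrict_iff' measurableSet_Ioo).1 hg
  refine (ae_restrict_iff' measurableSet_Ioo).2 ?_
  rw [← interval_coe] at hF hg' ⊢
  exact ae_riemannLiouville_of_ae_eq one_pos hF hα hβ hg'

theorem riemannLiouvilleOp_mul {a b : ℝ} {α β : ℂ} (hα : 0 < α.re) (hβ : 0 < β.re)
    (hαβ : 0 < (α + β).re) : riemannLiouvilleOp a b (α + β) hαβ =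
      riemannLiouvilleOp a b β hβ * riemannLiouvilleOp a b α hα := by
  ext1 f
  rw [mul_apply_eq_comp]
  apply Lp.ext
  filter_upwards [coeFn_riemannLiouvilleOp hαβ f,
    coeFn_riemannLiouvilleOp hβ (riemannLiouvilleOp a b α hα f),
    ae_riemannLiouville_of_ae_eq_Ioo (integrableOn_coe f) hα hβ
      (coeFn_riemannLiouvilleOp (b := b) hα f)] with x e1 e2 e3
  rw [e1, e2, e3]

theorem integOp_eq_riemannLiouvilleOp (a b : ℝ) :
    integOp a b = riemannLiouvilleOp a b 1 (by simp) := by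
  ext1 f
  apply Lp.ext
  filter_upwards [coeFn_integOp f, coeFn_riemannLiouvilleOp (α := 1) (by simp) f] with x e1 e2
  rw [e1, e2, integ_eq_riemannLiouville]

theorem integOp_pow_succ (a b : ℝ) (k : ℕ) :
    integOp a b ^ (k + 1) = riemannLiouvilleOp a b (k + 1 : ℕ) (natCast_succ_re_pos k) := by
  induction k with
  | zero => simp [integOp_eq_riemannLiouvilleOp]
  | succ k ih =>
    rw [pow_succ', ih, integOp_eq_riemannLiouvilleOp,
      ← riemannLiouvilleOp_mul (natCast_succ_re_pos k) (by simp) (by simp; positivity)]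
    congr 1
    push_cast
    ring

/-! ### Dependence of a Volterra operator on its kernel, and decay of the powers of `J`. -/

theorem norm_volterraOp_le {a b : ℝ} {k : ℝ → ℂ} (hk : IntegrableOn k (Ioo 0 (b - a))) :
    ‖volterraOp a b k hk‖ ≤ ∫ x in Ioo 0 (b - a), ‖k x‖ :=
  LinearMap.mkContinuous_norm_le _ (integral_nonneg fun _ => norm_nonneg _) _

theorem volterraOp_add {a b : ℝ} {k l : ℝ → ℂ} (hk : IntegrableOn k (Ioo 0 (b - a)))
    (hl : IntegrableOn l (Ioo 0 (b - a))) : volterraOp a b (k + l) (hk.add hl) =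
      volterraOp a b k hk + volterraOp a b l hl := by
  ext1 f
  apply Lp.ext
  rw [add_apply]
  filter_upwards [coeFn_volterraOp hk f, coeFn_volterraOp hl f, coeFn_volterraOp (hk.add hl) f,
    Lp.coeFn_add (volterraOp a b k hk f) (volterraOp a b l hl f),
    ae_integrableOn_volterra hk (integrableOn_coe f),
    ae_integrableOn_volterra hl (integrableOn_coe f)] with x e1 e2 e3 e4 i1 i2
  rw [e3, e4, Pi.add_apply, e1, e2, volterra, volterra, volterra, ← integral_add i1 i2]
  simp only [Pi.add_apply, mul_add]

theorem volterraOp_smul {a b : ℝ} {k : ℝ → ℂ} (hk : IntegrableOn k (Ioo 0 (b - a))) (c : ℂ)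
    (hck : IntegrableOn (c • k) (Ioo 0 (b - a))) :
    volterraOp a b (c • k) hck = c • volterraOp a b k hk := by
  ext1 f
  apply Lp.ext
  rw [smul_apply]
  filter_upwards [coeFn_volterraOp hk f, coeFn_volterraOp hck f,
    Lp.coeFn_smul c (volterraOp a b k hk f)] with x e1 e2 e3
  rw [e2, e3, Pi.smul_apply, e1, volterra, volterra, ← integral_smul]
  congr 1
  funext y
  simp only [Pi.smul_apply, smul_eq_mul]
  ring

theorem norm_volterraOp_sub_le {a b : ℝ} {k l : ℝ → ℂ} (hk : IntegrableOn k (Ioo 0 (b - a)))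
    (hl : IntegrableOn l (Ioo 0 (b - a))) :
    ‖volterraOp a b k hk - volterraOp a b l hl‖ ≤ ∫ x in Ioo 0 (b - a), ‖k x - l x‖ := by
  have hl' : IntegrableOn ((-1 : ℂ) • l) (Ioo 0 (b - a)) := Integrable.smul _ hl
  have h := norm_volterraOp_le (hk.add hl')
  rw [volterraOp_add hk hl', volterraOp_smul hl, neg_one_smul,
    ← sub_eq_add_neg] at h
  refine h.trans_eq ?_
  simp [sub_eq_add_neg]

theorem sum_smul_volterraOp {a b : ℝ} {ι : Type*} (s : Finset ι) (c : ι → ℂ) (k : ι → ℝ → ℂ)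
    (hk : ∀ i, IntegrableOn (k i) (Ioo 0 (b - a)))
    (hs : IntegrableOn (fun t => ∑ i ∈ s, c i * k i t) (Ioo 0 (b - a))) :
    ∑ i ∈ s, c i • volterraOp a b (k i) (hk i) =
      volterraOp a b (fun t => ∑ i ∈ s, c i * k i t) hs := by
  classical
  induction s using Finset.induction_on with
  | empty =>
    have h := norm_volterraOp_le hs
    simp only [Finset.sum_empty, norm_zero, integral_zero] at h ⊢
    exact (norm_le_zero_iff.1 h).symm
  | insert i s hi ih =>
    have h1 : IntegrableOn (fun t => ∑ i ∈ s, c i * k i t) (Ioo 0 (b - a)) :=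
      integrable_finsetSum _ fun i _ => (hk i).const_mul (c i)
    have h2 : IntegrableOn (c i • k i) (Ioo 0 (b - a)) := Integrable.smul _ (hk i)
    rw [Finset.sum_insert hi, ih h1, ← volterraOp_smul (hk i) _ h2, ← volterraOp_add h2 h1]
    congr 1
    funext t
    simp [Finset.sum_insert hi]

theorem norm_integOp_pow_le {a b : ℝ} (hab : a < b) (k : ℕ) :
    ‖integOp a b ^ (k + 1)‖ ≤ (b - a) * ((b - a) ^ k / k.factorial) := by
  rw [integOp_pow_succ]
  refine (norm_volterraOp_le _).trans ?_
  have h : ∀ t ∈ Ioo 0 (b - a), ‖rlKernel (k + 1 : ℕ) t‖ ≤ (b - a) ^ k / k.factorial := by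
    intro t ht
    rw [rlKernel_natCast, norm_mul, norm_inv, Complex.norm_natCast, norm_pow, Complex.norm_real,
      Real.norm_of_nonneg ht.1.le, inv_mul_eq_div]
    gcongr
    · exact ht.1.le
    · exact ht.2.le
  have h2 := norm_setIntegral_le_of_norm_le_const (μ := volume) (s := Ioo 0 (b - a))
    (f := fun t => ‖rlKernel (k + 1 : ℕ) t‖) (by simp) (fun t ht => by
      rw [norm_norm]
      exact h t ht)
  rw [Real.norm_of_nonneg (integral_nonneg fun _ => norm_nonneg _)] at h2
  refine h2.trans_eq ?_
  rw [Measure.real, Real.volume_Ioo, sub_zero, ENNReal.toReal_ofReal (by linarith), mul_comm]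

theorem hasEntireResolvent_integOp {a b : ℝ} (hab : a < b) : HasEntireResolvent (integOp a b) := by
  intro s hs
  rw [← summable_nat_add_iff 1]
  refine Summable.of_nonneg_of_le (fun _ => by positivity) (fun k => ?_)
    ((Real.summable_pow_div_factorial (s * (b - a))).mul_left (s * (b - a)))
  refine (mul_le_mul_of_nonneg_left (norm_integOp_pow_le hab k) (by positivity)).trans_eq ?_
  rw [mul_pow, pow_succ]
  ring


/-! ### Euler's integral for the kernel of `(J + ε)^β` -/

/-- `u^(1-β) ∫_0^1 e^(-uv) v^(-β) (1-v)^β dv`. -/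
def eulerIntegral (β : ℂ) (u : ℝ) : ℂ :=
  (u : ℂ) ^ (1 - β) * ∫ v in (0 : ℝ)..1, Complex.exp (-(u * v)) *
    ((v : ℂ) ^ (-β) * (1 - (v : ℂ)) ^ β)

/-- Substitution `w = uv`. The indicator puts all `u` on the same domain, ready for dominated
convergence. -/
theorem eulerIntegral_eq (β : ℂ) {u : ℝ} (hu : 0 < u) : eulerIntegral β u =
    ∫ w in Ioi (0 : ℝ), (Ioc 0 u).indicator (fun w : ℝ => Complex.exp (-w) *
      ((w : ℂ) ^ (-β) * ((1 - w / u : ℝ) : ℂ) ^ β)) w := by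
  have hu' : (u : ℂ) ≠ 0 := by exact_mod_cast hu.ne'
  have h := intervalIntegral.integral_comp_mul_left (a := 0) (b := 1) (fun w : ℝ =>
    Complex.exp (-w) * ((w : ℂ) ^ (-β) * ((1 - w / u : ℝ) : ℂ) ^ β)) hu.ne'
  rw [mul_zero, mul_one, intervalIntegral.integral_of_le hu.le] at h
  rw [setIntegral_indicator measurableSet_Ioc,
    inter_eq_right.2 fun w (hw : w ∈ Ioc 0 u) => mem_Ioi.2 hw.1]
  have h2 : ∫ v in (0 : ℝ)..1, Complex.exp (-((u * v : ℝ) : ℂ)) *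
      (((u * v : ℝ) : ℂ) ^ (-β) * ((1 - u * v / u : ℝ) : ℂ) ^ β) =
      (u : ℂ) ^ (-β) * ∫ v in (0 : ℝ)..1, Complex.exp (-(u * v)) *
        ((v : ℂ) ^ (-β) * (1 - (v : ℂ)) ^ β) := by
    rw [← intervalIntegral.integral_const_mul]
    refine intervalIntegral.integral_congr fun v hv => ?_
    rw [uIcc_of_le zero_le_one] at hv
    rw [mul_div_cancel_left₀ _ hu.ne', Complex.ofReal_mul,
      Complex.mul_cpow_ofReal_nonneg hu.le hv.1]
    push_cast
    ring
  rw [h2] at h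
  have h3 : (u : ℂ) ^ (1 - β) = u * (u : ℂ) ^ (-β) := by
    rw [sub_eq_add_neg, Complex.cpow_add _ _ hu', Complex.cpow_one]
  rw [eulerIntegral, h3, mul_assoc, h, Complex.real_smul, ← mul_assoc, Complex.ofReal_inv,
    mul_inv_cancel₀ hu', one_mul]

theorem integrableOn_exp_neg_mul_rpow_neg {r : ℝ} (hr : r < 1) :
    IntegrableOn (fun w : ℝ => Real.exp (-w) * w ^ (-r)) (Ioi 0) := by
  have h := Real.GammaIntegral_convergent (s := 1 - r) (by linarith)
  simpa using h

theorem norm_eulerIntegrand_le {β : ℂ} (hβ : 0 < β.re) {u : ℝ} (hu : 0 < u) {w : ℝ}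
    (hw : w ∈ Ioi (0 : ℝ)) :
    ‖(Ioc 0 u).indicator (fun w : ℝ => Complex.exp (-w) *
      ((w : ℂ) ^ (-β) * ((1 - w / u : ℝ) : ℂ) ^ β)) w‖ ≤ Real.exp (-w) * w ^ (-β.re) := by
  have hw0 : 0 < w := hw
  by_cases h : w ∈ Ioc 0 u
  · rw [indicator_of_mem h, norm_mul, norm_mul, Complex.norm_exp,
      Complex.norm_cpow_eq_rpow_re_of_pos hw0,
      Complex.norm_cpow_eq_rpow_re_of_nonneg _ hβ.ne']
    · simp only [Complex.neg_re, Complex.ofReal_re]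
      have h1 : (1 - w / u) ^ β.re ≤ 1 := by
        refine Real.rpow_le_one ?_ ?_ hβ.le
        · rw [sub_nonneg, div_le_one hu]
          exact h.2
        · have : 0 ≤ w / u := by positivity
          linarith
      have h2 : 0 ≤ w ^ (-β.re) := by positivity
      exact mul_le_mul_of_nonneg_left (mul_le_of_le_one_right h2 h1) (Real.exp_pos _).le
    · rw [sub_nonneg, div_le_one hu]
      exact h.2
  · rw [indicator_of_notMem h, norm_zero]
    positivity

theorem norm_eulerIntegral_le {β : ℂ} (hβ : 0 < β.re) (hβ1 : β.re < 1) {u : ℝ} (hu : 0 < u) :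
    ‖eulerIntegral β u‖ ≤ ∫ w in Ioi (0 : ℝ), Real.exp (-w) * w ^ (-β.re) := by
  rw [eulerIntegral_eq β hu]
  refine norm_integral_le_of_norm_le (integrableOn_exp_neg_mul_rpow_neg hβ1) ?_
  filter_upwards [ae_restrict_mem measurableSet_Ioi] with w hw
  exact norm_eulerIntegrand_le hβ hu hw

/-- As `u → ∞` the factor `(1 - w/u)^β` tends to `1` and stays bounded by `1` because `Re β > 0`;
`Re β < 1` makes `e^(-w) w^(-Re β)` an integrable majorant. -/
theorem tendsto_eulerIntegral {β : ℂ} (hβ : 0 < β.re) (hβ1 : β.re < 1) :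
    Tendsto (eulerIntegral β) atTop (𝓝 (Complex.Gamma (1 - β))) := by
  have h1 : Complex.Gamma (1 - β) = ∫ w in Ioi (0 : ℝ), Complex.exp (-w) * (w : ℂ) ^ (-β) := by
    rw [Complex.Gamma_eq_integral (by simp; linarith), Complex.GammaIntegral]
    simp
  rw [h1]
  have h2 : Tendsto (fun u : ℝ => ∫ w in Ioi (0 : ℝ), (Ioc 0 u).indicator (fun w : ℝ =>
      Complex.exp (-w) * ((w : ℂ) ^ (-β) * ((1 - w / u : ℝ) : ℂ) ^ β)) w) atTop
      (𝓝 (∫ w in Ioi (0 : ℝ), Complex.exp (-w) * (w : ℂ) ^ (-β))) := by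
    refine tendsto_integral_filter_of_dominated_convergence
      (fun w : ℝ => Real.exp (-w) * w ^ (-β.re)) (Eventually.of_forall fun u => ?_) ?_
      (integrableOn_exp_neg_mul_rpow_neg hβ1) ?_
    · refine (Measurable.indicator ?_ measurableSet_Ioc).aestronglyMeasurable
      fun_prop
    · filter_upwards [eventually_gt_atTop 0] with u hu
      filter_upwards [ae_restrict_mem measurableSet_Ioi] with w hw
      exact norm_eulerIntegrand_le hβ hu hw
    · filter_upwards [ae_restrict_mem measurableSet_Ioi] with w hw
      have h3 : Tendsto (fun u : ℝ => ((1 - w / u : ℝ) : ℂ)) atTop (𝓝 ((1 - 0 : ℝ) : ℂ)) :=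
        (Complex.continuous_ofReal.tendsto _).comp
          (tendsto_const_nhds.sub (tendsto_const_nhds.div_atTop tendsto_id))
      have h4 := h3.cpow (tendsto_const_nhds (x := β)) (by simp)
      rw [sub_zero, Complex.ofReal_one, Complex.one_cpow] at h4
      have h5 := (h4.const_mul ((w : ℂ) ^ (-β))).const_mul (Complex.exp (-w))
      rw [mul_one] at h5
      refine h5.congr' ?_
      filter_upwards [eventually_ge_atTop w] with u hu
      rw [indicator_of_mem (show w ∈ Ioc 0 u from ⟨hw, hu⟩)]
  refine h2.congr' ?_
  filter_upwards [eventually_gt_atTop 0] with u hu using (eulerIntegral_eq β hu).symm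

theorem choose_succ_eq_Gamma {β : ℂ} (hβ1 : β.re < 1) (k : ℕ) :
    Ring.choose β (k + 1) = (-1) ^ k * β * Complex.Gamma (k + 1 - β) /
      (Complex.Gamma (1 - β) * (k + 1).factorial) := by
  have h0 : Complex.Gamma (1 - β) ≠ 0 :=
    Complex.Gamma_ne_zero_of_re_pos (by simp; linarith)
  induction k with
  | zero =>
    have h := add_one_mul_choose_succ β 0
    simp only [Nat.cast_zero, zero_add, one_mul, Ring.choose_zero_right, mul_one, sub_zero] at h
    simp [h]
    field_simp
  | succ k ih =>
    have h := add_one_mul_choose_succ β (k + 1)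
    have h1 : ((k + 1 : ℕ) : ℂ) + 1 ≠ 0 := by exact_mod_cast (k + 1).succ_ne_zero
    have h2 : (k + 1 - β : ℂ) ≠ 0 := by
      intro h
      have := congrArg Complex.re h
      simp at this
      linarith [(Nat.cast_nonneg k : (0 : ℝ) ≤ k)]
    have h3 : Complex.Gamma ((k + 1 : ℕ) + 1 - β) =
        (k + 1 - β) * Complex.Gamma (k + 1 - β) := by
      rw [← Complex.Gamma_add_one _ h2]
      push_cast
      ring_nf
    apply mul_left_cancel₀ h1
    have h4 : ((k + 1).factorial : ℂ) ≠ 0 := by exact_mod_cast (k + 1).factorial_ne_zero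
    rw [h, ih, h3, Nat.factorial_succ (k + 1), pow_succ]
    push_cast at h1 ⊢
    field_simp
    ring

/-- Expanding `e^(-uv)` gives one beta integral for each power of `u`. -/
theorem hasSum_eulerIntegral {β : ℂ} (hβ : 0 < β.re) (hβ1 : β.re < 1) (u : ℝ) :
    HasSum (fun k : ℕ => (-u : ℂ) ^ k / k.factorial *
      Complex.betaIntegral (k + 1 - β) (1 + β)) (∫ v in (0 : ℝ)..1, Complex.exp (-(u * v)) *
        ((v : ℂ) ^ (-β) * (1 - (v : ℂ)) ^ β)) := by
  have hint := Complex.betaIntegral_convergent (u := 1 - β) (v := 1 + β)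
    (by simp; linarith) (by simp; linarith)
  simp only [sub_sub_cancel_left, add_sub_cancel_left] at hint
  have hexp : ∀ x : ℝ, Summable fun k : ℕ => |x| ^ k / k.factorial :=
    fun x => Real.summable_pow_div_factorial _
  have key : HasSum (fun k : ℕ => ∫ v in (0 : ℝ)..1, (-(u * v : ℂ)) ^ k / k.factorial *
      ((v : ℂ) ^ (-β) * (1 - (v : ℂ)) ^ β)) (∫ v in (0 : ℝ)..1, Complex.exp (-(u * v)) *
        ((v : ℂ) ^ (-β) * (1 - (v : ℂ)) ^ β)) := by
    refine intervalIntegral.hasSum_integral_of_dominated_convergence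
      (fun k v => |u| ^ k / k.factorial * ‖(v : ℂ) ^ (-β) * (1 - (v : ℂ)) ^ β‖)
      (fun k => ?_) (fun k => ?_) ?_ ?_ ?_
    · refine AEStronglyMeasurable.mul (Continuous.aestronglyMeasurable (by fun_prop)) ?_
      exact hint.def'.aestronglyMeasurable
    · refine Eventually.of_forall fun v hv => ?_
      rw [uIoc_of_le zero_le_one] at hv
      rw [norm_mul, norm_div, norm_pow, norm_neg, norm_mul, Complex.norm_real, Complex.norm_real,
        Complex.norm_natCast, Real.norm_eq_abs, Real.norm_of_nonneg hv.1.le]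
      gcongr
      · exact mul_nonneg (abs_nonneg u) hv.1.le
      · exact mul_le_of_le_one_right (abs_nonneg u) hv.2
    · exact Eventually.of_forall fun v _ => (hexp u).mul_right _
    · simp only [tsum_mul_right]
      exact hint.norm.const_mul _
    · refine Eventually.of_forall fun v _ => ?_
      have := NormedSpace.expSeries_div_hasSum_exp (𝔸 := ℂ) (-(u * v : ℂ))
      rw [← Complex.exp_eq_exp_ℂ] at this
      exact this.mul_right _
  refine key.congr_fun fun k => ?_
  rw [Complex.betaIntegral, ← intervalIntegral.integral_const_mul]
  refine intervalIntegral.integral_congr_ae (Eventually.of_forall fun v hv => ?_)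
  rw [uIoc_of_le zero_le_one] at hv
  have hv' : (v : ℂ) ≠ 0 := by exact_mod_cast hv.1.ne'
  have h1 : (v : ℂ) ^ (k + 1 - β - 1 : ℂ) = (v : ℂ) ^ k * (v : ℂ) ^ (-β) := by
    rw [← Complex.cpow_natCast, ← Complex.cpow_add _ _ hv']
    congr 1
    ring
  rw [h1, add_sub_cancel_left, ← neg_mul, mul_pow]
  ring

/-- Sums the kernels of the terms `k ≥ 1` of `(J + ε)^β`. The power series in `t/ε` has terms of
alternating sign for real `β`; its Euler integral form makes it possible to control it as `t/ε → ∞`.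
-/
theorem hasSum_shiftKernel {β : ℂ} (hβ : 0 < β.re) (hβ1 : β.re < 1) {ε t : ℝ} (hε : 0 < ε)
    (ht : 0 < t) :
    HasSum (fun k : ℕ => Ring.choose β (k + 1) * (ε : ℂ) ^ (β - (k + 1 : ℕ)) *
      rlKernel (k + 1 : ℕ) t)
      ((Complex.Gamma (1 - β))⁻¹ * eulerIntegral β (t / ε) * rlKernel β t) := by
  have hε' : (ε : ℂ) ≠ 0 := by exact_mod_cast hε.ne'
  have ht' : (t : ℂ) ≠ 0 := by exact_mod_cast ht.ne'
  have hβ0 : β ≠ 0 := fun h => by simp [h] at hβ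
  have g0 : Complex.Gamma (1 - β) ≠ 0 := Complex.Gamma_ne_zero_of_re_pos (by simp; linarith)
  have g1 : Complex.Gamma β ≠ 0 := Complex.Gamma_ne_zero_of_re_pos hβ
  have h := ((hasSum_eulerIntegral hβ hβ1 (t / ε)).mul_left (((t / ε : ℝ) : ℂ) ^ (1 - β))
    ).mul_left ((Complex.Gamma (1 - β))⁻¹ * rlKernel β t)
  rw [← eulerIntegral, mul_right_comm] at h
  refine h.congr_fun fun k => ?_
  have h1 : (t : ℂ) ^ (β - 1) * ((t / ε : ℝ) : ℂ) ^ (1 - β) = (ε : ℂ) ^ (β - 1) := by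
    have e : (t : ℂ) ^ (β - 1) * (t : ℂ) ^ (1 - β) = 1 := by
      rw [← Complex.cpow_add _ _ ht']
      simp
    rw [Complex.ofReal_div, Complex.div_cpow_ofReal_nonneg ht.le hε.le, ← mul_div_assoc, e,
      one_div, ← Complex.cpow_neg, neg_sub]
  have h2 : (ε : ℂ) ^ (β - (k + 1 : ℕ)) = (ε : ℂ) ^ (β - 1) * ((ε : ℂ) ^ k)⁻¹ := by
    rw [← Complex.cpow_natCast, ← Complex.cpow_neg, ← Complex.cpow_add _ _ hε']
    congr 1
    push_cast
    ring
  have h3 : Complex.betaIntegral (k + 1 - β) (1 + β) = Complex.Gamma (k + 1 - β) *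
      (β * Complex.Gamma β) / (k + 1).factorial := by
    rw [Complex.betaIntegral_eq_Gamma_mul_div _ _ (by
        simp
        linarith [(Nat.cast_nonneg k : (0 : ℝ) ≤ k)]) (by simp; linarith), add_comm 1 β,
      Complex.Gamma_add_one β hβ0, ← Complex.Gamma_nat_eq_factorial]
    congr 2
    push_cast
    ring
  have h4 : ((k + 1).factorial : ℂ) ≠ 0 := by exact_mod_cast (k + 1).factorial_ne_zero
  have h5 : (k.factorial : ℂ) ≠ 0 := by exact_mod_cast k.factorial_ne_zero
  rw [choose_succ_eq_Gamma hβ1, h2, ← h1, h3, rlKernel_natCast, rlKernel]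
  push_cast
  rw [neg_pow (t / ε : ℂ), div_pow]
  field_simp

/-! ### The limit of `(J + ε)^β` for `0 < Re β < 1` -/

/-- The term `k = 0` is a multiple of the identity of norm at most `ε^(Re β)`; the other terms are
Volterra operators, bounded by the `L¹` norm of their kernels. The estimate is made for partial sums
and passed to the limit. -/
theorem norm_shiftPow_sub_le {a b : ℝ} (hab : a < b) {β : ℂ} (hβ : 0 < β.re) (hβ1 : β.re < 1)
    {ε : ℝ} (hε : 0 < ε) :
    ‖shiftPow (integOp a b) β ε - riemannLiouvilleOp a b β hβ‖ ≤
      ε ^ β.re + ∫ t in Ioo 0 (b - a),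
        ‖(Complex.Gamma (1 - β))⁻¹ * eulerIntegral β (t / ε) * rlKernel β t - rlKernel β t‖ := by
  set c : ℕ → ℂ := fun k => Ring.choose β (k + 1) * (ε : ℂ) ^ (β - (k + 1 : ℕ)) with hc
  have hrl := fun k : ℕ => integrableOn_rlKernel (natCast_succ_re_pos k) (b - a)
  have hpart : ∀ N : ℕ, IntegrableOn (fun t => ∑ k ∈ Finset.range N,
      c k * rlKernel (k + 1 : ℕ) t) (Ioo 0 (b - a)) := fun N =>
    integrable_finsetSum _ fun k _ => (hrl k).const_mul (c k)
  have hsum := (((hasEntireResolvent_integOp hab).summable_shiftPow hβ hε).of_norm.hasSum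
    ).tendsto_sum_nat
  rw [← tendsto_add_atTop_iff_nat 1] at hsum
  have hle : ∀ N : ℕ, ‖∑ k ∈ Finset.range (N + 1),
      (Ring.choose β k * (ε : ℂ) ^ (β - k)) • integOp a b ^ k - riemannLiouvilleOp a b β hβ‖ ≤
      ε ^ β.re + ∫ t in Ioo 0 (b - a),
        ‖∑ k ∈ Finset.range N, c k * rlKernel (k + 1 : ℕ) t - rlKernel β t‖ := by
    intro N
    have h1 : ∑ k ∈ Finset.range N, (Ring.choose β (k + 1) * (ε : ℂ) ^ (β - (k + 1 : ℕ))) •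
        integOp a b ^ (k + 1) = volterraOp a b _ (hpart N) := by
      rw [← sum_smul_volterraOp _ c _ hrl]
      exact Finset.sum_congr rfl fun k _ => by rw [integOp_pow_succ, riemannLiouvilleOp]
    rw [Finset.sum_range_succ', h1, add_comm, add_sub_assoc]
    refine (norm_add_le _ _).trans (add_le_add ?_ (norm_volterraOp_sub_le _ _))
    rw [norm_smul, pow_zero, Ring.choose_zero_right, one_mul, norm_ofReal_cpow_sub_natCast β hε,
      pow_zero, mul_one]
    exact mul_le_of_le_one_right (by positivity) ContinuousLinearMap.norm_id_le
  set S := ∑' n, ‖pochhammerNewton n β‖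
  set g : ℕ → ℝ := fun k => S * (ε ^ β.re * (ε⁻¹) ^ (k + 1)) * ((b - a) ^ k / k.factorial) with hg
  have hgs : Summable g := by
    refine ((Real.summable_pow_div_factorial (ε⁻¹ * (b - a))).mul_left
      (S * ε ^ β.re * ε⁻¹)).congr fun k => ?_
    simp only [hg]
    rw [mul_pow, pow_succ]
    ring
  have hgb : ∀ k, ∀ t ∈ Ioo 0 (b - a), ‖c k * rlKernel (k + 1 : ℕ) t‖ ≤ g k := by
    intro k t ht
    simp only [hc]
    rw [rlKernel_natCast, norm_mul, norm_mul, norm_mul, norm_inv, Complex.norm_natCast, norm_pow,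
      Complex.norm_real, Real.norm_of_nonneg ht.1.le, norm_ofReal_cpow_sub_natCast β hε,
      inv_mul_eq_div]
    have h0 : 0 ≤ S := tsum_nonneg fun _ => norm_nonneg _
    simp only [hg]
    gcongr
    · exact div_nonneg (pow_nonneg ht.1.le _) (Nat.cast_nonneg _)
    · exact norm_choose_le hβ _
    · exact ht.1.le
    · exact ht.2.le
  have hlim : Tendsto (fun N : ℕ => ∫ t in Ioo 0 (b - a),
      ‖∑ k ∈ Finset.range N, c k * rlKernel (k + 1 : ℕ) t - rlKernel β t‖) atTop
      (𝓝 (∫ t in Ioo 0 (b - a),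
        ‖(Complex.Gamma (1 - β))⁻¹ * eulerIntegral β (t / ε) * rlKernel β t -
          rlKernel β t‖)) := by
    have hβi := integrableOn_rlKernel hβ (b - a)
    refine tendsto_integral_of_dominated_convergence (fun t => ∑' k, g k + ‖rlKernel β t‖)
      (fun N => ((hpart N).sub hβi).norm.aestronglyMeasurable)
      ((integrableOn_const (by simp)).add hβi.norm) (fun N => ?_) ?_
    · filter_upwards [ae_restrict_mem measurableSet_Ioo] with t ht
      rw [norm_norm]
      refine (norm_sub_le _ _).trans (add_le_add ?_ le_rfl)
      refine (norm_sum_le_of_le _ fun k _ => hgb k t ht).trans (hgs.sum_le_tsum _ fun k _ => ?_)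
      exact (norm_nonneg _).trans (hgb k t ht)
    · filter_upwards [ae_restrict_mem measurableSet_Ioo] with t ht
      exact (((hasSum_shiftKernel hβ hβ1 hε ht.1).tendsto_sum_nat).sub_const _).norm
  exact le_of_tendsto_of_tendsto' (hsum.sub_const _).norm (hlim.const_add _) hle

theorem tendsto_shiftPow_of_re_lt_one {a b : ℝ} (hab : a < b) {β : ℂ} (hβ : 0 < β.re)
    (hβ1 : β.re < 1) : Tendsto (shiftPow (integOp a b) β) (𝓝[>] 0)
      (𝓝 (riemannLiouvilleOp a b β hβ)) := by
  have g0 : Complex.Gamma (1 - β) ≠ 0 := Complex.Gamma_ne_zero_of_re_pos (by simp; linarith)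
  set K := ∫ w in Ioi (0 : ℝ), Real.exp (-w) * w ^ (-β.re)
  have hβi := integrableOn_rlKernel hβ (b - a)
  have h1 : Tendsto (fun ε : ℝ => ε ^ β.re) (𝓝[>] 0) (𝓝 0) := by
    have := (Real.continuousAt_rpow_const 0 β.re (Or.inr hβ.le)).tendsto
    rw [Real.zero_rpow hβ.ne'] at this
    exact this.mono_left nhdsWithin_le_nhds
  have hfac : ∀ ε t : ℝ, (Complex.Gamma (1 - β))⁻¹ * eulerIntegral β (t / ε) * rlKernel β t -
      rlKernel β t = ((Complex.Gamma (1 - β))⁻¹ * eulerIntegral β (t / ε) - 1) * rlKernel β t :=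
    fun ε t => by ring
  have h2 : Tendsto (fun ε : ℝ => ∫ t in Ioo 0 (b - a),
      ‖(Complex.Gamma (1 - β))⁻¹ * eulerIntegral β (t / ε) * rlKernel β t - rlKernel β t‖)
      (𝓝[>] 0) (𝓝 (∫ t in Ioo 0 (b - a), (0 : ℝ))) := by
    refine tendsto_integral_filter_of_dominated_convergence
      (fun t => (‖(Complex.Gamma (1 - β))⁻¹‖ * K + 1) * ‖rlKernel β t‖) ?_ ?_
      (hβi.norm.const_mul _) ?_
    · filter_upwards [self_mem_nhdsWithin] with ε hε
      -- Measurability in `t` comes from the partial sums of the kernel series rather than from the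
      -- parametric integral.
      have hm : AEStronglyMeasurable (fun t => (Complex.Gamma (1 - β))⁻¹ *
          eulerIntegral β (t / ε) * rlKernel β t) (volume.restrict (Ioo 0 (b - a))) := by
        refine aestronglyMeasurable_of_tendsto_ae (u := atTop) (f := fun N t =>
          ∑ k ∈ Finset.range N, Ring.choose β (k + 1) * (ε : ℂ) ^ (β - (k + 1 : ℕ)) *
            rlKernel (k + 1 : ℕ) t) (fun N => ?_) ?_
        · refine Measurable.aestronglyMeasurable (Finset.measurable_fun_sum _ fun k _ => ?_)
          exact (measurable_rlKernel _).const_mul _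
        · filter_upwards [ae_restrict_mem measurableSet_Ioo] with t ht
          exact (hasSum_shiftKernel hβ hβ1 hε ht.1).tendsto_sum_nat
      exact (hm.sub hβi.aestronglyMeasurable).norm
    · filter_upwards [self_mem_nhdsWithin] with ε hε
      filter_upwards [ae_restrict_mem measurableSet_Ioo] with t ht
      rw [norm_norm, hfac, norm_mul]
      refine mul_le_mul_of_nonneg_right ((norm_sub_le _ _).trans ?_) (norm_nonneg _)
      rw [norm_mul, norm_one]
      gcongr
      exact norm_eulerIntegral_le hβ hβ1 (div_pos ht.1 hε)
    · filter_upwards [ae_restrict_mem measurableSet_Ioo] with t ht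
      have h3 : Tendsto (fun ε : ℝ => t / ε) (𝓝[>] 0) atTop := by
        simp only [div_eq_mul_inv]
        exact tendsto_inv_nhdsGT_zero.const_mul_atTop ht.1
      have h4 := (((tendsto_eulerIntegral hβ hβ1).comp h3).const_mul
        (Complex.Gamma (1 - β))⁻¹).sub_const 1 |>.mul_const (rlKernel β t) |>.norm
      rw [inv_mul_cancel₀ g0, sub_self, zero_mul, norm_zero] at h4
      exact h4.congr fun ε => by rw [hfac]; rfl
  rw [integral_zero] at h2
  have h3 := h1.add h2
  rw [add_zero] at h3
  rw [tendsto_iff_norm_sub_tendsto_zero]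
  refine squeeze_zero' (Eventually.of_forall fun _ => norm_nonneg _) ?_ h3
  filter_upwards [self_mem_nhdsWithin] with ε hε using norm_shiftPow_sub_le hab hβ hβ1 hε

theorem tendsto_shiftPow_natCast_mul {a b : ℝ} (hab : a < b) {β : ℂ} (hβ : 0 < β.re)
    (hβ1 : β.re < 1) (n : ℕ) (h : 0 < ((n + 1 : ℕ) * β).re) :
    Tendsto (shiftPow (integOp a b) ((n + 1 : ℕ) * β)) (𝓝[>] 0)
      (𝓝 (riemannLiouvilleOp a b ((n + 1 : ℕ) * β) h)) := by
  induction n with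
  | zero => simpa using tendsto_shiftPow_of_re_lt_one hab hβ hβ1
  | succ n ih =>
    have hn : 0 < (((n + 1 : ℕ) : ℂ) * β).re := by
      rw [← Complex.ofReal_natCast, Complex.re_ofReal_mul]
      positivity
    have e : ((n + 1 + 1 : ℕ) : ℂ) * β = β + (n + 1 : ℕ) * β := by
      push_cast
      ring
    -- The exponent is generalized because the operator carries a proof about it, which obstructs
    -- rewriting.
    have key : ∀ (γ : ℂ) (hγ : 0 < γ.re), γ = β + (n + 1 : ℕ) * β →
        Tendsto (shiftPow (integOp a b) γ) (𝓝[>] 0) (𝓝 (riemannLiouvilleOp a b γ hγ)) := by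
      rintro _ hγ rfl
      rw [riemannLiouvilleOp_mul hβ hn]
      refine ((ih hn).mul (tendsto_shiftPow_of_re_lt_one hab hβ hβ1)).congr' ?_
      filter_upwards [self_mem_nhdsWithin] with ε hε
      rw [add_comm β, (hasEntireResolvent_integOp hab).shiftPow_add hn hβ hε]
    exact key _ h e

theorem tendsto_shiftPow {a b : ℝ} (hab : a < b) {α : ℂ} (hα : 0 < α.re) :
    Tendsto (shiftPow (integOp a b) α) (𝓝[>] 0) (𝓝 (riemannLiouvilleOp a b α hα)) := by
  -- With `n > Re α` the exponent `β = α / (n + 1)` has real part strictly between `0` and `1`.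
  obtain ⟨n, hn⟩ := exists_nat_gt α.re
  have hn0 : (0 : ℝ) < (n : ℝ) + 1 := by positivity
  obtain ⟨β, hβ⟩ : ∃ β : ℂ, α = (n + 1 : ℕ) * β :=
    ⟨α / (n + 1 : ℕ), by rw [mul_div_cancel₀ _ (by exact_mod_cast n.succ_ne_zero)]⟩
  have hre : α.re = ((n : ℝ) + 1) * β.re := by
    rw [hβ, ← Complex.ofReal_natCast, Complex.re_ofReal_mul]
    push_cast
    ring
  have h0 : 0 < β.re := by
    rw [hre] at hα
    exact (mul_pos_iff_of_pos_left hn0).1 hα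
  have h1 : β.re < 1 := by nlinarith
  subst hβ
  exact tendsto_shiftPow_natCast_mul hab h0 h1 n hα

theorem isFractionalPower_integOp {a b : ℝ} (hab : a < b) {α : ℂ} (hα : 0 < α.re) :
    IsFractionalPower (integOp a b) α (riemannLiouvilleOp a b α hα) := by
  have hJ := hasEntireResolvent_integOp hab
  refine ⟨shiftPow (integOp a b) α, fun ε hε => ?_, tendsto_shiftPow hab hα⟩
  refine ⟨ε, ε / 2, closedBall_subset_slitPlane hε, (hJ.spectrum_subset (ε : ℂ)).trans ?_,
    (hJ.circleIntegral_eq α hε).symm⟩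
  rw [singleton_subset_iff]
  exact Metric.mem_ball_self (by positivity)

end FracInt

end

theorem mainTheorem11 (α : ℂ) (hα : 0 < α.re) :
    -- bounded intervals: identity of bounded operators on `L¹(a, b)`
    (∀ a b : ℝ, a < b →
      FracInt.IsFractionalPower (FracInt.integOp a b) α (FracInt.riemannLiouvilleOp a b α hα) ∧
      ∀ ρ : ℝ, 0 < ρ →
        Tendsto (FracInt.newtonSum ρ α (FracInt.integOp a b)) atTop
          (𝓝 (FracInt.riemannLiouvilleOp a b α hα))) ∧
    -- arbitrary intervals: identity in `L¹(a, c)` for every finite `c ≤ b`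
    (∀ (a b : EReal) (f : ℝ → ℂ) (ρ : ℝ), a < b → 0 < ρ →
      IntegrableOn f (FracInt.interval a b) →
      (a = ⊥ → ∃ ε : ℝ, 1 / ρ < ε ∧
        f =O[atBot ⊓ ae volume] fun x => Real.exp (ε * x)) →
      ∀ c : ℝ, (c : EReal) ≤ b →
        (∀ k : ℕ, IntegrableOn ((FracInt.integ a)^[k] f) (FracInt.interval a c)) ∧
        (∀ᵐ x ∂(volume.restrict (FracInt.interval a c)),
          IntegrableOn (fun y => f y * ((x - y : ℝ) : ℂ) ^ (α - 1)) (FracInt.interval a x)) ∧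
        IntegrableOn (FracInt.riemannLiouville a α f) (FracInt.interval a c) ∧
        Tendsto (fun N => eLpNorm
            (fun x => FracInt.newtonSumFun a ρ α f N x - FracInt.riemannLiouville a α f x) 1
            (volume.restrict (FracInt.interval a c)))
          atTop (𝓝 0)) := by
  refine ⟨fun a b hab => ⟨FracInt.isFractionalPower_integOp hab hα,
    fun ρ hρ => FracInt.newton_series_operator hα a b hρ⟩, ?_⟩
  intro a b f ρ hab hρ hf hO c hc
  exact FracInt.newton_series_function hα a b f ρ hab hρ hf hO c hc
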